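/- Let $M\ge 1$ and $P_1,\dots,P_M\ge 0$. For each $N$ let $\mathbf a(N)\in\{1,\dots,M\}^N$ be a deterministic vector (coordinate $a_k$ is the sub-band of frequency $k$) such that, for every $m$, $\frac1N|\{k: a_k(N)=m\}|\to\delta_m$ as $N\to\infty$. Put $\overline P=\sum_{m=1}^M\delta_mP_m$ and assume $\overline P>0$. Let $Q_{\rm tx}:\mathbb C\to\mathbb C$ be Lipschitz, let $\mathbf Q_{\rm tx}$ denote its componentwise application to vectors, and define, for $U\sim\mathcal{CN}(0,\overline P)$, $$\alpha_{\rm tx}=\frac1{\overline P}\,\mathbb E\big[\overline{U}\,Q_{\rm tx}(U)\big],\qquad \tau_{\rm tx}=\frac1{\overline P}\,\mathbb E\big|Q_{\rm tx}(U)-\alpha_{\rm tx}U\big|^2 .$$ On one probability space let there be, for each $N$, a Haar-distributed random $N\times N$ unitary matrix $\mathbf V=\mathbf V(N)$ and, independent of it, a random vector $\mathbf z=\mathbf z(N)\in\mathbb C^N$ with independent components $z_k\sim\mathcal{CN}(0,P_m)$ when $a_k=m$ (the joint law across different $N$ is arbitrary). Let $\mathbf x=\mathbf Q_{\rm tx}(\mathbf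 V^{\sf H}\mathbf z)$ and $\mathbf r=\mathbf V\mathbf x$. Then, almost surely as $N\to\infty$: 1. for every $m$, $\displaystyle \frac1N\sum_{k:\,a_k=m}|r_k|^2\to\delta_m\big(|\alpha_{\rm tx}|^2P_m+\tau_{\rm tx}\overline P\big)$; 2. $\displaystyle \frac1N\|\mathbf x\|^2\;\Big(=\frac1N\|\mathbf r\|^2\Big)\to\big(|\alpha_{\rm tx}|^2+\tau_{\rm tx}\big)\overline P$; 3. (additive Gaussian noise model) the components of $(\mathbf r,\mathbf z,\mathbf a)$ converge empirically with second-order moments to $(R,Z,A)$, where $R=\alpha_{\rm tx}Z+W$, $\Pr(A=m)=\delta_m$, $Z\sim\mathcal{CN}(0,P_m)$ given $A=m$, and $W\sim\mathcal{CN}(0,\tau_{\rm tx}\overline P)$ is independent of $(Z,A)$. That is, for all $f:\mathbb C\times\mathbb C\times\mathbb R\to\mathbb R$ simultaneously that satisfy, for some $C>0$, $|f(x)-f(y)|\le C\|x-y\|(1+\|x\|+\|y\|)$ for all $x,y$, the expectation $\mathbb E f(R,Z,A)$ is finite and $\frac1N\sum_{k} f(r_k,z_k,a_k)\to\mathbb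 E f(R,Z,A)$. -/

import Mathlib

open MeasureTheory ProbabilityTheory Filter Topology
open scoped Matrix ComplexConjugate

noncomputable section

namespace TransformQuantization

/-- The group of `N × N` complex unitary matrices carries its Borel σ-algebra. -/
instance instMeasurableSpaceUnitary (N : ℕ) :
    MeasurableSpace (Matrix.unitaryGroup (Fin N) ℂ) := borel _

instance instBorelSpaceUnitary (N : ℕ) :
    BorelSpace (Matrix.unitaryGroup (Fin N) ℂ) := ⟨rfl⟩

/-- The circularly symmetric complex Gaussian law `CN(0, v)`, for `v ≥ 0`: real and imaginary
parts are independent real Gaussians, each of variance `v / 2`. -/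
def complexGaussian (v : ℝ) : Measure ℂ :=
  ((gaussianReal 0 (v / 2).toNNReal).prod (gaussianReal 0 (v / 2).toNNReal)).map
    (fun p : ℝ × ℝ => (⟨p.1, p.2⟩ : ℂ))

/-- A random unitary matrix which is Haar distributed, i.e. uniform on the unitary group. -/
def IsHaarUnitary {Ω : Type*} [MeasurableSpace Ω] {N : ℕ}
    (V : Ω → Matrix.unitaryGroup (Fin N) ℂ) (μ : Measure Ω) : Prop :=
  AEMeasurable V μ ∧ (μ.map V).IsHaarMeasure

/-- The transmitted vector `x = Q(Vᴴ z)`, the scalar function `Q` acting componentwise. -/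
def transmitted {N : ℕ} (Q : ℂ → ℂ) (V : Matrix.unitaryGroup (Fin N) ℂ) (z : Fin N → ℂ) :
    Fin N → ℂ :=
  fun n => Q (((V : Matrix (Fin N) (Fin N) ℂ)ᴴ *ᵥ z) n)

/-- The frequency-domain representation `r = V x` of the transmitted vector. -/
def spectrumVec {N : ℕ} (Q : ℂ → ℂ) (V : Matrix.unitaryGroup (Fin N) ℂ) (z : Fin N → ℂ) :
    Fin N → ℂ :=
  (V : Matrix (Fin N) (Fin N) ℂ) *ᵥ transmitted Q V z

/-- The fraction of the `N` frequencies that lie in sub-band `m`. -/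
def bandFraction {N M : ℕ} (a : Fin N → Fin M) (m : Fin M) : ℝ :=
  (1 / (N : ℝ)) * ∑ k, if a k = m then (1 : ℝ) else 0

/-- The energy per sample of `r` in sub-band `m`. -/
def bandEnergy {N M : ℕ} (a : Fin N → Fin M) (m : Fin M) (r : Fin N → ℂ) : ℝ :=
  (1 / (N : ℝ)) * ∑ k, if a k = m then ‖r k‖ ^ 2 else 0

/-- The average symbol energy `∑ₘ δₘ Pₘ`. -/
def avgPower {M : ℕ} (δ P : Fin M → ℝ) : ℝ := ∑ m, δ m * P m

/-- The linear gain `E[conj U * Q U] / p` for `U ∼ CN(0, p)`. -/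
def gain (Q : ℂ → ℂ) (p : ℝ) : ℂ :=
  (1 / (p : ℂ)) * ∫ u, conj u * Q u ∂(complexGaussian p)

/-- The normalized distortion `E|Q U - α U|² / p` for `U ∼ CN(0, p)`, with `α` the linear gain. -/
def distortion (Q : ℂ → ℂ) (p : ℝ) : ℝ :=
  (1 / p) * ∫ u, ‖Q u - gain Q p * u‖ ^ 2 ∂(complexGaussian p)

/-- Pseudo-Lipschitz functions of order `p`. -/
def PseudoLipschitz {E : Type*} [NormedAddCommGroup E] (p : ℕ) (f : E → ℝ) : Prop :=
  ∃ C : ℝ, 0 < C ∧ ∀ x y : E,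
    |f x - f y| ≤ C * ‖x - y‖ * (1 + ‖x‖ ^ (p - 1) + ‖y‖ ^ (p - 1))

/-- The components of the vectors `y N` converge empirically, with `p`-th order moments, to a
random variable of law `ν`. -/
def ConvergesEmpirically {E : Type*} [NormedAddCommGroup E] [MeasurableSpace E] (p : ℕ)
    (y : (N : ℕ) → Fin N → E) (ν : Measure E) : Prop :=
  ∀ f : E → ℝ, PseudoLipschitz p f →
    Integrable f ν ∧
      Tendsto (fun N : ℕ => (1 / (N : ℝ)) * ∑ k, f (y N k)) atTop (𝓝 (∫ e, f e ∂ν))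

/-- The joint law of `(α Z + W, Z, A)`, where `A` has `Pr(A = m) = δₘ`, where `Z ∼ CN(0, Pₘ)`
given `A = m`, and where `W ∼ CN(0, s)` is independent of `(Z, A)`. Sub-band labels are regarded
as real numbers. -/
def agnLaw {M : ℕ} (δ P : Fin M → ℝ) (α : ℂ) (s : ℝ) : Measure (ℂ × ℂ × ℝ) :=
  ∑ m, ENNReal.ofReal (δ m) •
    ((complexGaussian (P m)).prod (complexGaussian s)).map
      (fun q : ℂ × ℂ => (α * q.1 + q.2, q.1, ((m : ℕ) : ℝ)))

end TransformQuantization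

end

open TransformQuantization

open scoped ENNReal

noncomputable section

namespace TransformQuantization

/-! Condition on `z`. If a unitary `B` fixes `z`, then replacing `V` by `B V` leaves `Vᴴ z`, hence
`x`, unchanged and turns `r = V x` into `B r`. By Haar invariance the component of `r` orthogonal to
`z` has a uniform direction in `z⊥`. Its length and the coefficient of `r` along `z` are functions
of `u = Vᴴ z` alone, because `V` is an isometry, and `u` is uniform on the sphere of radius `‖z‖`.
Uniform directions are realised by normalised Gaussian vectors `h` (for `u`) and `g` (projected to
`z⊥`). This gives a model of `(r, z)` built from the independent triples `(z_k, h_k, g_k)`: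
`measure_prod_spectrumVec_le`.

In the model the law of large numbers `tendsto_average` does the rest. Write `p` for the average
power. Then `‖z‖²/N → p`, `‖h‖²/N → 1`, `‖g‖²/N → 1` and `⟨z, g⟩/N → 0`. Since `Q` is Lipschitz, `u
= (‖z‖/‖h‖) h` may be replaced by `√p h`, so the coefficient along `z` tends to the gain `α` and the
normalised length of the rest tends to `√(τ p)`. Hence `r = α z + √(τ p) g + o(√N)` in Euclidean
norm (`spectrumModel_tendsto`), and averages of test functions over `(r, z)` become averages of
independent terms.

The model reproduces the law for each `N` separately, and the joint law over `N` is arbitrary.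
Limits are therefore taken in the sense of complete convergence (summable failure probabilities),
which depends only on the law at each `N` and implies almost sure convergence by Borel–Cantelli
(`ae_tendsto_of_summableFilter`). Encoding it as a filter makes the usual calculus of limits
available. A countable family of test functions then produces one null set for all test functions
(`tendsto_of_testFamily`); both energy statements come from the test function `‖r‖²`. -/

/-- The filter of events with summable probabilities of failure along a sequence of measure
spaces. Convergence along it is complete convergence. -/
def summableFilter {Ω : ℕ → Type*} [∀ N, MeasurableSpace (Ω N)] (μ : ∀ N, Measure (Ω N)) :
    Filter (Σ N, Ω N) where
  sets := {S | ∑' N, μ N {ω | (⟨N, ω⟩ : Σ N, Ω N) ∉ S} ≠ ∞}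
  univ_sets := by simp
  sets_of_superset {S T} hS hST := by
    refine ne_top_of_le_ne_top hS (ENNReal.tsum_le_tsum fun N => measure_mono ?_)
    exact fun ω hω h => hω (hST h)
  inter_sets {S T} hS hT := by
    refine ne_top_of_le_ne_top (ENNReal.add_ne_top.2 ⟨hS, hT⟩) ?_
    rw [← ENNReal.tsum_add]
    refine ENNReal.tsum_le_tsum fun N => (measure_mono ?_).trans (measure_union_le _ _)
    intro ω hω
    by_cases h : (⟨N, ω⟩ : Σ N, Ω N) ∈ S
    · exact Or.inr fun h' => hω ⟨h, h'⟩
    · exact Or.inl h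

/-! ### Complete convergence and the Borel–Cantelli lemma. -/

section SummableFilter

variable {Ω : ℕ → Type*} [∀ N, MeasurableSpace (Ω N)] {μ : ∀ N, Measure (Ω N)}

lemma eventually_summableFilter {p : (Σ N, Ω N) → Prop} :
    (∀ᶠ x in summableFilter μ, p x) ↔ ∑' N, μ N {ω | ¬ p ⟨N, ω⟩} ≠ ∞ := Iff.rfl

lemma tendsto_fst_summableFilter [∀ N, IsFiniteMeasure (μ N)] :
    Tendsto (fun x : Σ N, Ω N => x.1) (summableFilter μ) atTop := by
  refine tendsto_atTop.2 fun n => eventually_summableFilter.2 ?_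
  rw [tsum_eq_sum (s := Finset.range n)]
  · exact ENNReal.sum_ne_top.2 fun N _ => measure_ne_top _ _
  · intro N hN
    have : n ≤ N := by simpa using hN
    simp [this]

lemma eventually_summableFilter_of_le {b : ℕ → ℝ} (hb : Summable b) (hb0 : ∀ N, 0 ≤ b N)
    [∀ N, IsFiniteMeasure (μ N)] {p : (Σ N, Ω N) → Prop}
    (h : ∀ᶠ N in atTop, μ N {ω | ¬ p ⟨N, ω⟩} ≤ ENNReal.ofReal (b N)) :
    ∀ᶠ x in summableFilter μ, p x := by
  obtain ⟨n, hn⟩ := eventually_atTop.1 h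
  -- The alternative `x.1 < n` empties the failure events of the finitely many `N` without a bound.
  have h2 : ∀ᶠ x in summableFilter μ, x.1 < n ∨ p x := by
    refine eventually_summableFilter.2 (ne_top_of_le_ne_top (b := ∑' N, ENNReal.ofReal (b N)) ?_
      (ENNReal.tsum_le_tsum fun N => ?_))
    · rw [← ENNReal.ofReal_tsum_of_nonneg hb0 hb]
      exact ENNReal.ofReal_ne_top
    · by_cases hN : N < n
      · simp [hN]
      · simpa [hN] using hn N (not_lt.1 hN)
  filter_upwards [h2, tendsto_fst_summableFilter.eventually_ge_atTop n] with x hx hx'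
  exact hx.resolve_left (not_lt.2 hx')

/-- First Borel–Cantelli lemma: it needs no independence, so the `T N` may be coupled arbitrarily. A
countable neighbourhood basis of the limit keeps the exceptional set null. -/
lemma ae_tendsto_of_summableFilter {Ω' : Type*} [MeasurableSpace Ω'] {μ' : Measure Ω'}
    {T : ∀ N, Ω' → Ω N} (hT : ∀ N, AEMeasurable (T N) μ') (hμ : ∀ N, μ'.map (T N) = μ N)
    {E : Type*} [TopologicalSpace E] [FirstCountableTopology E] {F : (Σ N, Ω N) → E} {e : E}
    (hF : Tendsto F (summableFilter μ) (𝓝 e)) :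
    ∀ᵐ ω ∂μ', Tendsto (fun N => F ⟨N, T N ω⟩) atTop (𝓝 e) := by
  obtain ⟨u, hu⟩ := (𝓝 e).exists_antitone_basis
  have : ∀ n, ∀ᵐ ω ∂μ', ∀ᶠ N in atTop, F ⟨N, T N ω⟩ ∈ u n := by
    intro n
    have h := eventually_summableFilter.1 (hF (hu.1.mem_of_mem (i := n) trivial))
    have h2 : ∑' N, μ' {ω | ¬ F ⟨N, T N ω⟩ ∈ u n} ≠ ∞ := by
      refine ne_top_of_le_ne_top h (ENNReal.tsum_le_tsum fun N => ?_)
      rw [← hμ N]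
      -- Only this inequality is needed, so the failure set need not be measurable.
      exact Measure.le_map_apply (hT N) _
    filter_upwards [ae_eventually_notMem h2] with ω hω
    filter_upwards [hω] with N hN
    simpa using hN
  filter_upwards [ae_all_iff.2 this] with ω hω
  exact hu.1.tendsto_right_iff.2 fun n _ => hω n

end SummableFilter

/-! ### Fourth moments of sums of independent variables. -/

section FourthMoment

variable {Ω : Type*} [MeasurableSpace Ω] {μ : Measure Ω} [IsProbabilityMeasure μ]

lemma MemLp.integrable_pow' {X : Ω → ℝ} (h : MemLp X 4 μ) {n : ℕ} (hn : n ≤ 4) :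
    Integrable (fun ω => X ω ^ n) μ := by
  have h1 : MemLp X n μ := h.mono_exponent (by exact_mod_cast hn)
  have h2 := h1.integrable_norm_pow'
  refine h2.mono (h.1.pow n) (.of_forall fun ω => by simp)

/-- Second and fourth moments of a sum of independent centred variables. -/
lemma moment_four_sum_le {ι : Type*} {X : ι → Ω → ℝ} (hX : iIndepFun X μ)
    (h4 : ∀ i, MemLp (X i) 4 μ) (h0 : ∀ i, ∫ ω, X i ω ∂μ = 0) {b : ℝ}
    (hb : 1 ≤ b) (hb2 : ∀ i, ∫ ω, X i ω ^ 2 ∂μ ≤ b) (hb4 : ∀ i, ∫ ω, X i ω ^ 4 ∂μ ≤ b)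
    (s : Finset ι) :
    ∫ ω, (∑ i ∈ s, X i ω) ^ 2 ∂μ ≤ s.card * b ∧
      ∫ ω, (∑ i ∈ s, X i ω) ^ 4 ∂μ ≤ 3 * (s.card : ℝ) ^ 2 * b ^ 2 := by
  classical
  induction s using Finset.induction_on with
  | empty => simp
  | insert i s hi ih =>
    set S : Ω → ℝ := fun ω => ∑ j ∈ s, X j ω with hS
    have hS4 : MemLp S 4 μ := memLp_finsetSum s fun j _ => h4 j
    have hind : IndepFun S (X i) μ := by
      have := hX.indepFun_finsetSum_of_notMem₀ (fun j => (h4 j).1.aemeasurable) hi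
      convert this using 1
      ext ω; simp [hS]
    have hSi : ∀ {n}, n ≤ 4 → Integrable (fun ω => S ω ^ n) μ := fun hn =>
      MemLp.integrable_pow' hS4 hn
    have hXi : ∀ {n}, n ≤ 4 → Integrable (fun ω => X i ω ^ n) μ := fun hn =>
      MemLp.integrable_pow' (h4 i) hn
    have hpow : ∀ m n : ℕ, IndepFun (fun ω => S ω ^ m) (fun ω => X i ω ^ n) μ := fun m n =>
      hind.comp (φ := fun x => x ^ m) (ψ := fun x => x ^ n) (by fun_prop) (by fun_prop)
    have hint : ∀ {m n : ℕ}, m ≤ 4 → n ≤ 4 → Integrable (fun ω => S ω ^ m * X i ω ^ n) μ :=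
      fun hm hn => (hpow _ _).integrable_mul (hSi hm) (hXi hn)
    have hmul : ∀ m n : ℕ, ∫ ω, S ω ^ m * X i ω ^ n ∂μ =
        (∫ ω, S ω ^ m ∂μ) * ∫ ω, X i ω ^ n ∂μ := fun m n =>
      (hpow m n).integral_fun_mul_eq_mul_integral ((hS4.1.pow m)) ((h4 i).1.pow n)
    have hS0 : ∫ ω, S ω ∂μ = 0 := by
      rw [hS, integral_finsetSum]
      · simp [h0]
      · exact fun j _ => (h4 j).integrable (by norm_num)
    have e2 : ∫ ω, (S ω + X i ω) ^ 2 ∂μ = ∫ ω, S ω ^ 2 ∂μ + ∫ ω, X i ω ^ 2 ∂μ := by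
      have : (fun ω => (S ω + X i ω) ^ 2) =
          fun ω => S ω ^ 2 * X i ω ^ 0 + 2 * (S ω ^ 1 * X i ω ^ 1) + S ω ^ 0 * X i ω ^ 2 := by
        ext ω; ring
      rw [this, integral_add, integral_add, integral_const_mul, hmul, hmul, hmul]
      · simp [h0]
      · exact hint (by norm_num) (by norm_num)
      · exact (hint (by norm_num) (by norm_num)).const_mul _
      · exact (hint (by norm_num) (by norm_num)).add
          ((hint (by norm_num) (by norm_num)).const_mul _)
      · exact hint (by norm_num) (by norm_num)
    -- The terms in `S³ X` and `S X³` vanish because `X i` and `S` are centred.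
    have e4 : ∫ ω, (S ω + X i ω) ^ 4 ∂μ = ∫ ω, S ω ^ 4 ∂μ +
        6 * ((∫ ω, S ω ^ 2 ∂μ) * ∫ ω, X i ω ^ 2 ∂μ) + ∫ ω, X i ω ^ 4 ∂μ := by
      have : (fun ω => (S ω + X i ω) ^ 4) =
          fun ω => S ω ^ 4 * X i ω ^ 0 + 4 * (S ω ^ 3 * X i ω ^ 1) + 6 * (S ω ^ 2 * X i ω ^ 2)
            + 4 * (S ω ^ 1 * X i ω ^ 3) + S ω ^ 0 * X i ω ^ 4 := by
        ext ω; ring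
      have i0 : Integrable (fun ω => S ω ^ 4 * X i ω ^ 0) μ := hint (by norm_num) (by norm_num)
      have i1 : Integrable (fun ω => 4 * (S ω ^ 3 * X i ω ^ 1)) μ :=
        (hint (by norm_num) (by norm_num)).const_mul _
      have i2 : Integrable (fun ω => 6 * (S ω ^ 2 * X i ω ^ 2)) μ :=
        (hint (by norm_num) (by norm_num)).const_mul _
      have i3 : Integrable (fun ω => 4 * (S ω ^ 1 * X i ω ^ 3)) μ :=
        (hint (by norm_num) (by norm_num)).const_mul _
      have i4 : Integrable (fun ω => S ω ^ 0 * X i ω ^ 4) μ := hint (by norm_num) (by norm_num)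
      rw [this, integral_add, integral_add, integral_add, integral_add]
      · simp only [integral_const_mul, hmul]
        simp [h0, hS0]
      · exact i0
      · exact i1
      · exact i0.add i1
      · exact i2
      · exact (i0.add i1).add i2
      · exact i3
      · exact ((i0.add i1).add i2).add i3
      · exact i4
    have hadd : ∀ ω, ∑ j ∈ insert i s, X j ω = S ω + X i ω := fun ω => by
      rw [Finset.sum_insert hi, add_comm]
    simp only [hadd, e2, e4, Finset.card_insert_of_notMem hi]
    have hX0 : 0 ≤ ∫ ω, X i ω ^ 2 ∂μ := integral_nonneg fun ω => by positivity
    have hm : (∫ ω, S ω ^ 2 ∂μ) * ∫ ω, X i ω ^ 2 ∂μ ≤ (s.card * b) * b :=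
      mul_le_mul ih.1 (hb2 i) hX0 (by positivity)
    have := hb2 i
    have := hb4 i
    have h1 := ih.1
    have h2 := ih.2
    refine ⟨by push_cast; linarith, ?_⟩
    push_cast
    -- With `n = s.card`: `3n²b² + 6nb² + b ≤ 3(n+1)²b²`, where `1 ≤ b` absorbs the last `b`.
    nlinarith

end FourthMoment

/-! ### Law of large numbers for triangular arrays with finitely many laws. -/

section LawOfLargeNumbers

variable {M : ℕ} {E : Type*} [MeasurableSpace E] {lam : Fin M → Measure E}
  [∀ m, IsProbabilityMeasure (lam m)] {a : ∀ N : ℕ, Fin N → Fin M} {δ : Fin M → ℝ}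

lemma sum_band_eq {N : ℕ} (a : Fin N → Fin M) (c : Fin M → ℝ) :
    (1 / (N : ℝ)) * ∑ k, c (a k) = ∑ m, bandFraction a m * c m := by
  have : ∀ m, bandFraction a m * c m =
      (1 / (N : ℝ)) * ∑ k, if a k = m then c m else 0 := fun m => by
    rw [bandFraction, mul_assoc, Finset.sum_mul]
    congr 1
    exact Finset.sum_congr rfl fun k _ => by split_ifs <;> simp
  simp_rw [this, ← Finset.mul_sum]
  rw [Finset.sum_comm]
  simp

/-- A strong law of large numbers for triangular arrays, in the form of complete convergence. -/
lemma tendsto_average (hδ : ∀ m, Tendsto (fun N => bandFraction (a N) m) atTop (𝓝 (δ m)))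
    (f : Fin M → E → ℝ) (hf : ∀ m, MemLp (f m) 4 (lam m)) :
    Tendsto (fun x : Σ N, (Fin N → E) => (1 / (x.1 : ℝ)) * ∑ k, f (a x.1 k) (x.2 k))
      (summableFilter fun N => Measure.pi fun k => lam (a N k))
      (𝓝 (∑ m, δ m * ∫ e, f m e ∂lam m)) := by
  set c : Fin M → ℝ := fun m => ∫ e, f m e ∂lam m with hc
  have hc1 : Tendsto (fun x : Σ N, (Fin N → E) => (1 / (x.1 : ℝ)) * ∑ k, c (a x.1 k))
      (summableFilter fun N => Measure.pi fun k => lam (a N k)) (𝓝 (∑ m, δ m * c m)) := by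
    have : Tendsto (fun N => ∑ m, bandFraction (a N) m * c m) atTop (𝓝 (∑ m, δ m * c m)) :=
      tendsto_finsetSum _ fun m _ => (hδ m).mul_const _
    refine (this.comp tendsto_fst_summableFilter).congr fun x => ?_
    exact (sum_band_eq _ _).symm
  set g : Fin M → E → ℝ := fun m e => f m e - c m with hg
  have hg4 : ∀ m, MemLp (g m) 4 (lam m) := fun m => (hf m).sub (memLp_const _)
  have hg0 : ∀ m, ∫ e, g m e ∂lam m = 0 := fun m => by
    simp only [hg]
    rw [integral_sub ((hf m).integrable (by norm_num)) (integrable_const _)]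
    simp [hc]
  obtain ⟨b, hb1, hb2, hb4⟩ : ∃ b : ℝ, 1 ≤ b ∧ (∀ m, ∫ e, g m e ^ 2 ∂lam m ≤ b) ∧
      ∀ m, ∫ e, g m e ^ 4 ∂lam m ≤ b := by
    have p2 : ∀ m, 0 ≤ ∫ e, g m e ^ 2 ∂lam m := fun m => integral_nonneg fun _ => by positivity
    have p4 : ∀ m, 0 ≤ ∫ e, g m e ^ 4 ∂lam m := fun m => integral_nonneg fun _ => by positivity
    refine ⟨1 + (∑ m, ∫ e, g m e ^ 2 ∂lam m) + ∑ m, ∫ e, g m e ^ 4 ∂lam m, ?_, ?_, ?_⟩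
    · have := Finset.sum_nonneg fun m (_ : m ∈ Finset.univ) => p2 m
      have := Finset.sum_nonneg fun m (_ : m ∈ Finset.univ) => p4 m
      linarith
    · intro m
      have := Finset.single_le_sum (fun m _ => p2 m) (Finset.mem_univ m)
      have := Finset.sum_nonneg fun m (_ : m ∈ Finset.univ) => p4 m
      linarith
    · intro m
      have := Finset.single_le_sum (fun m _ => p4 m) (Finset.mem_univ m)
      have := Finset.sum_nonneg fun m (_ : m ∈ Finset.univ) => p2 m
      linarith
  have hg1 : Tendsto (fun x : Σ N, (Fin N → E) => (1 / (x.1 : ℝ)) * ∑ k, g (a x.1 k) (x.2 k))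
      (summableFilter fun N => Measure.pi fun k => lam (a N k)) (𝓝 0) := by
    refine Metric.tendsto_nhds.2 fun ε hε => ?_
    -- Markov's inequality for the fourth power: `3N²b² / (Nε)⁴` is summable in `N`, whereas the
    -- second moment would only give a bound of order `1/N`.
    refine eventually_summableFilter_of_le (b := fun N : ℕ => (3 * b ^ 2 / ε ^ 4) * (1 / (N : ℝ) ^ 2))
      ((Real.summable_one_div_nat_pow.2 (by norm_num)).mul_left _) (fun N => by positivity) ?_
    filter_upwards [eventually_gt_atTop 0] with N hN
    have hN' : (0 : ℝ) < N := by exact_mod_cast hN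
    set ν := Measure.pi fun k => lam (a N k)
    have hmp : ∀ k, MeasurePreserving (Function.eval k) ν (lam (a N k)) := fun k =>
      measurePreserving_eval (fun k => lam (a N k)) k
    set X : Fin N → (Fin N → E) → ℝ := fun k ω => g (a N k) (ω k) with hX
    have hX4 : ∀ k, MemLp (X k) 4 ν := fun k => (hg4 _).comp_measurePreserving (hmp k)
    have hXi : ∀ k (φ : ℝ → ℝ), Measurable φ →
        ∫ ω, φ (X k ω) ∂ν = ∫ e, φ (g (a N k) e) ∂lam (a N k) := fun k φ hφ => by
      rw [← (hmp k).map_eq, integral_map (hmp k).measurable.aemeasurable]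
      · rw [(hmp k).map_eq]
        exact (hφ.comp_aemeasurable (hg4 _).1.aemeasurable).aestronglyMeasurable
    have hind : iIndepFun X ν := iIndepFun_pi fun k => (hg4 _).1.aemeasurable
    have hm := (moment_four_sum_le hind hX4
      (fun k => (hXi k (fun x => x) measurable_id).trans (hg0 _)) hb1
      (fun k => (hXi k (fun x => x ^ 2) (by fun_prop)).trans_le (hb2 _))
      (fun k => (hXi k (fun x => x ^ 4) (by fun_prop)).trans_le (hb4 _)) Finset.univ).2
    have hS4 : MemLp (fun ω => ∑ k, X k ω) 4 ν := memLp_finsetSum _ fun j _ => hX4 j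
    have hmk := mul_meas_ge_le_integral_of_nonneg (μ := ν) (f := fun ω => (∑ k, X k ω) ^ 4)
      (.of_forall fun ω => by positivity) (MemLp.integrable_pow' hS4 le_rfl) ((N * ε) ^ 4)
    have hsub : {ω | ¬ dist ((1 / (N : ℝ)) * ∑ k, g (a N k) (ω k)) 0 < ε} ⊆
        {ω | (N * ε) ^ 4 ≤ (∑ k, X k ω) ^ 4} := fun ω hω => by
      simp only [Set.mem_ofPred_eq, not_lt, dist_zero_right, norm_mul, Real.norm_eq_abs] at hω ⊢
      rw [abs_of_pos (by positivity : 0 < 1 / (N : ℝ)), one_div, ← div_eq_inv_mul,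
        le_div_iff₀ hN', mul_comm] at hω
      calc (N * ε) ^ 4 ≤ |∑ k, X k ω| ^ 4 := pow_le_pow_left₀ (by positivity) hω _
        _ = _ := by rw [← abs_pow, abs_of_nonneg (by positivity)]
    refine (measure_mono hsub).trans ?_
    rw [← ENNReal.ofReal_toReal (measure_ne_top ν _)]
    refine ENNReal.ofReal_le_ofReal ?_
    have hpos : 0 < (N * ε) ^ 4 := by positivity
    calc _ ≤ (3 * (N : ℝ) ^ 2 * b ^ 2) / (N * ε) ^ 4 := by
          rw [le_div_iff₀ hpos, mul_comm]
          refine hmk.trans ?_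
          simpa using hm
      _ = _ := by field_simp
  have := hg1.add hc1
  rw [zero_add] at this
  refine this.congr fun x => ?_
  simp [hg, ← mul_add]

lemma tendsto_average_complex
    (hδ : ∀ m, Tendsto (fun N => bandFraction (a N) m) atTop (𝓝 (δ m)))
    (f : Fin M → E → ℂ) (hf : ∀ m, MemLp (f m) 4 (lam m)) :
    Tendsto (fun x : Σ N, (Fin N → E) => (1 / (x.1 : ℂ)) * ∑ k, f (a x.1 k) (x.2 k))
      (summableFilter fun N => Measure.pi fun k => lam (a N k))
      (𝓝 (∑ m, (δ m : ℂ) * ∫ e, f m e ∂lam m)) := by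
  have hre := tendsto_average hδ (fun m e => (f m e).re) fun m => (hf m).re
  have him := tendsto_average hδ (fun m e => (f m e).im) fun m => (hf m).im
  have h := ((Complex.continuous_ofReal.tendsto _).comp hre).add
    (((Complex.continuous_ofReal.tendsto _).comp him).mul_const Complex.I)
  have hint : ∀ m, Integrable (f m) (lam m) := fun m => (hf m).integrable (by norm_num)
  convert h using 1
  · ext x
    apply Complex.ext
    · simp
    · simp
  · congr 1
    push_cast
    rw [Finset.sum_mul, ← Finset.sum_add_distrib]
    refine Finset.sum_congr rfl fun m _ => ?_
    have := integral_re_add_im (hint m)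
    simp only [RCLike.re_eq_complex_re, RCLike.im_eq_complex_im, RCLike.I_to_complex,
      Complex.coe_algebraMap] at this
    rw [mul_assoc, ← mul_add]
    exact congrArg _ this.symm

end LawOfLargeNumbers

/-! ### Scaling, moments and characteristic function of `CN(0, v)`. -/

section ComplexGaussian

lemma measurable_complex_mk : Measurable fun p : ℝ × ℝ => (⟨p.1, p.2⟩ : ℂ) :=
  Complex.measurableEquivRealProd.symm.measurable

instance isProbabilityMeasure_complexGaussian (v : ℝ) :
    IsProbabilityMeasure (complexGaussian v) :=
  Measure.isProbabilityMeasure_map measurable_complex_mk.aemeasurable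

lemma complexGaussian_map_ofReal_mul (c v : ℝ) (hv : 0 ≤ v) :
    (complexGaussian v).map (fun z => (c : ℂ) * z) = complexGaussian (c ^ 2 * v) := by
  rw [complexGaussian, complexGaussian, Measure.map_map (by fun_prop) measurable_complex_mk]
  have h : (gaussianReal 0 (v / 2).toNNReal).map (fun x => c * x) =
      gaussianReal 0 (c ^ 2 * v / 2).toNNReal := by
    rw [gaussianReal_map_const_mul]
    congr 1
    · simp
    · ext
      rw [NNReal.coe_mul, Real.coe_toNNReal _ (by positivity), Real.coe_toNNReal _ (by positivity)]
      simp; ring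
  rw [← h, Measure.map_prod_map _ _ (by fun_prop) (by fun_prop),
    Measure.map_map measurable_complex_mk (by fun_prop)]
  congr 1
  ext p
  apply Complex.ext <;> simp

lemma memLp_id_complexGaussian (v : ℝ) (p : NNReal) : MemLp id p (complexGaussian v) := by
  rw [complexGaussian, memLp_map_measure_iff (by fun_prop) measurable_complex_mk.aemeasurable]
  have h1 : MemLp (fun q : ℝ × ℝ => q.1) p ((gaussianReal 0 (v / 2).toNNReal).prod
      (gaussianReal 0 (v / 2).toNNReal)) :=
    (memLp_id_gaussianReal p).comp_measurePreserving measurePreserving_fst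
  have h2 : MemLp (fun q : ℝ × ℝ => q.2) p ((gaussianReal 0 (v / 2).toNNReal).prod
      (gaussianReal 0 (v / 2).toNNReal)) :=
    (memLp_id_gaussianReal p).comp_measurePreserving measurePreserving_snd
  refine (h1.norm.add h2.norm).mono (measurable_complex_mk.aestronglyMeasurable)
    (.of_forall fun q => ?_)
  simp only [id, Function.comp, Pi.add_apply]
  refine (Complex.norm_le_abs_re_add_abs_im _).trans ?_
  exact le_abs_self _

lemma integral_id_complexGaussian (v : ℝ) : ∫ z, z ∂complexGaussian v = 0 := by
  have hi : Integrable (fun z : ℂ => z) (complexGaussian v) :=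
    (memLp_id_complexGaussian v 1).integrable le_rfl
  rw [← integral_re_add_im hi]
  have e1 : ∫ z : ℂ, RCLike.re z ∂complexGaussian v = 0 := by
    rw [complexGaussian, integral_map measurable_complex_mk.aemeasurable (by fun_prop)]
    have := integral_fun_fst (μ := gaussianReal 0 (v / 2).toNNReal)
      (ν := gaussianReal 0 (v / 2).toNNReal) (fun x : ℝ => x)
    simpa using this
  have e2 : ∫ z : ℂ, RCLike.im z ∂complexGaussian v = 0 := by
    rw [complexGaussian, integral_map measurable_complex_mk.aemeasurable (by fun_prop)]
    have := integral_fun_snd (μ := gaussianReal 0 (v / 2).toNNReal)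
      (ν := gaussianReal 0 (v / 2).toNNReal) (fun x : ℝ => x)
    simpa using this
  rw [e1, e2]; simp

lemma integral_norm_sq_complexGaussian {v : ℝ} (hv : 0 ≤ v) :
    ∫ z, ‖z‖ ^ 2 ∂complexGaussian v = v := by
  rw [complexGaussian, integral_map measurable_complex_mk.aemeasurable (by fun_prop)]
  have e : ∀ p : ℝ × ℝ, ‖(⟨p.1, p.2⟩ : ℂ)‖ ^ 2 = p.1 ^ 2 + p.2 ^ 2 := fun p => by
    rw [Complex.sq_norm, Complex.normSq_mk]; ring
  have hs : Integrable (fun x : ℝ => x ^ 2) (gaussianReal 0 (v / 2).toNNReal) :=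
    (memLp_id_gaussianReal 2).integrable_sq
  have hv2 : ∫ x, x ^ 2 ∂gaussianReal 0 (v / 2).toNNReal = v / 2 := by
    have := variance_id_gaussianReal (μ := 0) (v := (v / 2).toNNReal)
    rw [variance_of_integral_eq_zero (by fun_prop) (by simp)] at this
    simpa [max_eq_left (by positivity : 0 ≤ v / 2)] using this
  simp_rw [e]
  rw [integral_add]
  · have h1 := integral_fun_fst (μ := gaussianReal 0 (v / 2).toNNReal)
      (ν := gaussianReal 0 (v / 2).toNNReal) (fun x : ℝ => x ^ 2)
    have h2 := integral_fun_snd (μ := gaussianReal 0 (v / 2).toNNReal)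
      (ν := gaussianReal 0 (v / 2).toNNReal) (fun x : ℝ => x ^ 2)
    rw [h1, h2, hv2]; simp
  · exact hs.comp_fst _
  · exact hs.comp_snd _

/-- The dependence on `‖t‖` alone is the source of unitary invariance of Gaussian vectors. -/
lemma charFun_complexGaussian_one (t : ℂ) :
    charFun (complexGaussian 1) t = Complex.exp (-(‖t‖ ^ 2 / 4 : ℝ)) := by
  have h := fun s : ℝ => charFun_gaussianReal (μ := 0) (v := (1 / 2 : ℝ).toNNReal) s
  simp only [charFun_apply_real] at h
  rw [charFun_apply, complexGaussian, integral_map measurable_complex_mk.aemeasurable (by fun_prop)]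
  have e : ∀ p : ℝ × ℝ, Complex.exp (inner ℝ (⟨p.1, p.2⟩ : ℂ) t * Complex.I) =
      Complex.exp (t.re * p.1 * Complex.I) * Complex.exp (t.im * p.2 * Complex.I) := fun p => by
    rw [← Complex.exp_add, Complex.inner]
    congr 1
    simp; ring
  simp_rw [e]
  rw [integral_prod_mul (fun x : ℝ => Complex.exp (t.re * x * Complex.I))
    (fun x : ℝ => Complex.exp (t.im * x * Complex.I)), h, h, ← Complex.exp_add, Complex.sq_norm,
    Complex.normSq_apply]
  congr 1
  rw [Real.coe_toNNReal _ (by norm_num)]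
  push_cast
  ring

end ComplexGaussian

/-! ### Topology of the unitary group. -/

section UnitaryTopology

variable {N : ℕ}

instance secondCountableTopology_unitaryGroup :
    SecondCountableTopology (Matrix.unitaryGroup (Fin N) ℂ) :=
  haveI : SecondCountableTopology (Matrix (Fin N) (Fin N) ℂ) :=
    inferInstanceAs (SecondCountableTopology (Fin N → Fin N → ℂ))
  TopologicalSpace.Subtype.secondCountableTopology
    (Matrix.unitaryGroup (Fin N) ℂ : Set (Matrix (Fin N) (Fin N) ℂ))

/-- Entries of a unitary matrix lie in the closed unit disc. Compactness passes to stabilizers of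
vectors, whose Haar measure is then finite. -/
instance compactSpace_unitaryGroup : CompactSpace (Matrix.unitaryGroup (Fin N) ℂ) := by
  refine isCompact_iff_compactSpace.1 ?_
  have hc : @IsCompact (Matrix (Fin N) (Fin N) ℂ) _
      (Set.pi Set.univ fun _ : Fin N => Set.pi Set.univ fun _ : Fin N =>
        Metric.closedBall (0 : ℂ) 1) :=
    isCompact_univ_pi fun _ => isCompact_univ_pi fun _ => isCompact_closedBall _ _
  refine hc.of_isClosed_subset (isClosed_unitary (R := Matrix (Fin N) (Fin N) ℂ)) ?_
  intro A hA i _ j _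
  simpa using entry_norm_bound_of_unitary hA i j

lemma continuous_coe_unitaryGroup : Continuous fun A : Matrix.unitaryGroup (Fin N) ℂ =>
    (A : Matrix (Fin N) (Fin N) ℂ) := continuous_subtype_val

end UnitaryTopology

/-! ### Orthogonal decomposition along a vector, and unitary maps between vectors of equal norm. -/

section Euclidean

variable {N : ℕ}

/-- The Euclidean norm of a complex vector. -/
def nrm (v : Fin N → ℂ) : ℝ := ‖WithLp.toLp 2 v‖

lemma nrm_sq (v : Fin N → ℂ) : nrm v ^ 2 = ∑ k, ‖v k‖ ^ 2 :=
  EuclideanSpace.norm_sq_eq _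

lemma nrm_nonneg (v : Fin N → ℂ) : 0 ≤ nrm v := norm_nonneg _

lemma nrm_eq_zero {v : Fin N → ℂ} : nrm v = 0 ↔ v = 0 := by
  simp [nrm]

lemma nrm_smul (c : ℂ) (v : Fin N → ℂ) : nrm (c • v) = ‖c‖ * nrm v := by
  simp [nrm, norm_smul]

lemma nrm_add_le (v w : Fin N → ℂ) : nrm (v + w) ≤ nrm v + nrm w := by
  simpa [nrm] using norm_add_le (WithLp.toLp 2 v) (WithLp.toLp 2 w)

lemma abs_nrm_sub_le (v w : Fin N → ℂ) : |nrm v - nrm w| ≤ nrm (v - w) := by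
  simpa [nrm] using abs_norm_sub_norm_le (WithLp.toLp 2 v) (WithLp.toLp 2 w)

lemma star_dotProduct_self (v : Fin N → ℂ) : star v ⬝ᵥ v = ((nrm v ^ 2 : ℝ) : ℂ) := by
  rw [nrm_sq, dotProduct]
  push_cast
  refine Finset.sum_congr rfl fun k _ => ?_
  simpa using Complex.conj_mul' (v k)

lemma norm_star_dotProduct_le (v w : Fin N → ℂ) : ‖star v ⬝ᵥ w‖ ≤ nrm v * nrm w := by
  have := norm_inner_le_norm (𝕜 := ℂ) (WithLp.toLp 2 v) (WithLp.toLp 2 w)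
  rwa [EuclideanSpace.inner_toLp_toLp, dotProduct_comm] at this

lemma continuous_nrm : Continuous (nrm : (Fin N → ℂ) → ℝ) :=
  continuous_norm.comp (PiLp.continuous_toLp 2 _)

lemma star_dotProduct_mulVec (A : Matrix (Fin N) (Fin N) ℂ) (v w : Fin N → ℂ) :
    star v ⬝ᵥ (A *ᵥ w) = star (Aᴴ *ᵥ v) ⬝ᵥ w := by
  rw [Matrix.dotProduct_mulVec, Matrix.star_mulVec, Matrix.conjTranspose_conjTranspose]

lemma conjTranspose_mulVec_mulVec (A : Matrix.unitaryGroup (Fin N) ℂ) (v : Fin N → ℂ) :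
    (A : Matrix (Fin N) (Fin N) ℂ)ᴴ *ᵥ ((A : Matrix (Fin N) (Fin N) ℂ) *ᵥ v) = v := by
  rw [Matrix.mulVec_mulVec, ← Matrix.star_eq_conjTranspose, Matrix.UnitaryGroup.star_mul_self,
    Matrix.one_mulVec]

lemma star_mulVec_dotProduct_mulVec (A : Matrix.unitaryGroup (Fin N) ℂ) (v w : Fin N → ℂ) :
    star ((A : Matrix (Fin N) (Fin N) ℂ) *ᵥ v) ⬝ᵥ ((A : Matrix (Fin N) (Fin N) ℂ) *ᵥ w) =
      star v ⬝ᵥ w := by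
  rw [star_dotProduct_mulVec, conjTranspose_mulVec_mulVec]

lemma nrm_mulVec (A : Matrix.unitaryGroup (Fin N) ℂ) (v : Fin N → ℂ) :
    nrm ((A : Matrix (Fin N) (Fin N) ℂ) *ᵥ v) = nrm v := by
  have h := star_mulVec_dotProduct_mulVec A v v
  rw [star_dotProduct_self, star_dotProduct_self, Complex.ofReal_inj] at h
  exact (pow_left_inj₀ (nrm_nonneg _) (nrm_nonneg _) two_ne_zero).1 h

/-- The coefficient of the projection of `g` on the line spanned by `z`. -/
def coef (z g : Fin N → ℂ) : ℂ := (star z ⬝ᵥ g) / (star z ⬝ᵥ z)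

/-- The component of `g` orthogonal to `z`. -/
def perp (z g : Fin N → ℂ) : Fin N → ℂ := g - coef z g • z

lemma star_dotProduct_perp (z g : Fin N → ℂ) : star z ⬝ᵥ perp z g = 0 := by
  rw [perp, coef, dotProduct_sub, dotProduct_smul, smul_eq_mul]
  by_cases hz : star z ⬝ᵥ z = 0
  · have : z = 0 := by
      rw [star_dotProduct_self] at hz
      exact nrm_eq_zero.1 (by simpa using hz)
    simp [this]
  · field_simp
    ring

/-- With `w = 0` in `measure_orbit_le`, the stabilizer is the full unitary group and the sphere is
that of the whole space. -/
lemma perp_zero_left (g : Fin N → ℂ) : perp 0 g = g := by simp [perp]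

lemma coef_mulVec (A : Matrix.unitaryGroup (Fin N) ℂ) (z g : Fin N → ℂ) :
    coef ((A : Matrix (Fin N) (Fin N) ℂ) *ᵥ z) ((A : Matrix (Fin N) (Fin N) ℂ) *ᵥ g) =
      coef z g := by
  simp only [coef, star_mulVec_dotProduct_mulVec]

lemma perp_mulVec (A : Matrix.unitaryGroup (Fin N) ℂ) (z g : Fin N → ℂ) :
    perp ((A : Matrix (Fin N) (Fin N) ℂ) *ᵥ z) ((A : Matrix (Fin N) (Fin N) ℂ) *ᵥ g) =
      (A : Matrix (Fin N) (Fin N) ℂ) *ᵥ perp z g := by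
  rw [perp, coef_mulVec, perp, Matrix.mulVec_sub, Matrix.mulVec_smul]

lemma measurable_dotProduct {α : Type*} [MeasurableSpace α] {f g : α → Fin N → ℂ}
    (hf : Measurable f) (hg : Measurable g) : Measurable fun x => star (f x) ⬝ᵥ g x := by
  have hf' := measurable_pi_iff.1 hf
  have hg' := measurable_pi_iff.1 hg
  refine Finset.measurable_sum _ fun k _ => Measurable.mul ?_ (hg' k)
  exact (continuous_star.measurable).comp (hf' k)

lemma measurable_coef {α : Type*} [MeasurableSpace α] {f g : α → Fin N → ℂ}
    (hf : Measurable f) (hg : Measurable g) : Measurable fun x => coef (f x) (g x) :=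
  (measurable_dotProduct hf hg).div (measurable_dotProduct hf hf)

lemma measurable_perp {α : Type*} [MeasurableSpace α] {f g : α → Fin N → ℂ}
    (hf : Measurable f) (hg : Measurable g) : Measurable fun x => perp (f x) (g x) :=
  hg.sub ((measurable_coef hf hg).smul hf)

/-- A generalized reflection that moves `v` to `w` and fixes a vector orthogonal to both. -/
lemma exists_unitary_mulVec_eq {z v w : Fin N → ℂ} (hvw : nrm v = nrm w)
    (hv : star z ⬝ᵥ v = 0) (hw : star z ⬝ᵥ w = 0) :
    ∃ A : Matrix.unitaryGroup (Fin N) ℂ, (A : Matrix (Fin N) (Fin N) ℂ) *ᵥ z = z ∧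
      (A : Matrix (Fin N) (Fin N) ℂ) *ᵥ v = w := by
  by_cases hne : v = w
  · exact ⟨1, by simp, by simp [hne]⟩
  set d := v - w with hd
  have hd0 : d ≠ 0 := sub_ne_zero.2 hne
  -- Since `⟨v, w⟩` need not be real, the Householder factor `2/‖d‖²` is replaced by `c⁻¹`. Equality
  -- of norms gives `‖d‖² = c + conj c`, which yields both `c ≠ 0` and the unitarity of `1 - c⁻¹ d
  -- dᴴ`.
  set c : ℂ := star d ⬝ᵥ v with hc
  have hdd : star d ⬝ᵥ d = c + conj c := by
    have h1 : star v ⬝ᵥ v = star w ⬝ᵥ w := by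
      rw [star_dotProduct_self, star_dotProduct_self, hvw]
    have h2 : conj c = star v ⬝ᵥ d := by
      rw [hc, starRingEnd_apply, ← Matrix.star_dotProduct_star, star_star, dotProduct_comm]
    rw [h2, hc, hd]
    simp only [star_sub, sub_dotProduct, dotProduct_sub]
    rw [h1]; ring
  have hc0 : c ≠ 0 := by
    intro h
    rw [h, star_dotProduct_self] at hdd
    exact hd0 (nrm_eq_zero.1 (by simpa using hdd))
  have hc0' : conj c ≠ 0 := by simpa using hc0
  set A : Matrix (Fin N) (Fin N) ℂ := 1 - c⁻¹ • Matrix.vecMulVec d (star d) with hA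
  have hAH : star A = 1 - (conj c)⁻¹ • Matrix.vecMulVec d (star d) := by
    rw [hA, star_sub, star_one, star_smul, Matrix.star_eq_conjTranspose,
      Matrix.conjTranspose_vecMulVec, star_star]
    simp
  have hAu : A ∈ Matrix.unitaryGroup (Fin N) ℂ := by
    rw [Matrix.mem_unitaryGroup_iff, hAH, hA]
    have hP : Matrix.vecMulVec d (star d) * Matrix.vecMulVec d (star d) =
        (c + conj c) • Matrix.vecMulVec d (star d) := by
      rw [Matrix.vecMulVec_mul_vecMulVec, hdd]
      ext i j; simp [Matrix.vecMulVec_apply]; ring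
    rw [sub_mul, mul_sub, mul_sub, mul_one, mul_one, one_mul, smul_mul_smul_comm, hP, smul_smul]
    have : c⁻¹ * (conj c)⁻¹ * (c + conj c) = c⁻¹ + (conj c)⁻¹ := by field_simp; ring
    rw [this, add_smul]
    abel
  have hmul : ∀ x, A *ᵥ x = x - (c⁻¹ * (star d ⬝ᵥ x)) • d := fun x => by
    rw [hA, Matrix.sub_mulVec, Matrix.one_mulVec, Matrix.smul_mulVec, Matrix.vecMulVec_mulVec]
    ext i; simp; ring
  refine ⟨⟨A, hAu⟩, ?_, ?_⟩
  · have hz : star d ⬝ᵥ z = 0 := by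
      have : star z ⬝ᵥ d = 0 := by rw [hd, dotProduct_sub, hv, hw, sub_zero]
      rw [← star_star z, Matrix.star_dotProduct_star, this, star_zero]
    rw [hmul, hz]; simp
  · rw [hmul, ← hc, inv_mul_cancel₀ hc0, one_smul, hd, sub_sub_cancel]

end Euclidean

/-! ### Unitary invariance of Gaussian vectors. -/

section GaussianInvariance

/-- The law of a vector of independent standard complex Gaussian variables. -/
def gaussianVec (N : ℕ) : Measure (Fin N → ℂ) := Measure.pi fun _ => complexGaussian 1

instance isProbabilityMeasure_gaussianVec (N : ℕ) : IsProbabilityMeasure (gaussianVec N) :=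
  inferInstanceAs (IsProbabilityMeasure (Measure.pi fun _ => complexGaussian 1))

variable {N : ℕ}

lemma charFun_gaussianVec (t : PiLp 2 fun _ : Fin N => ℂ) :
    charFun ((gaussianVec N).map (WithLp.toLp 2)) t = Complex.exp (-(‖t‖ ^ 2 / 4 : ℝ)) := by
  rw [gaussianVec, charFun_pi]
  simp_rw [charFun_complexGaussian_one]
  rw [← Complex.exp_sum, EuclideanSpace.norm_sq_eq]
  push_cast
  rw [Finset.sum_neg_distrib, Finset.sum_div]

/-- The characteristic function at `t` becomes the one at `Aᴴ t`, and these agree as `Aᴴ` preserves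
the norm. The detour through `PiLp 2` supplies the inner product. -/
lemma gaussianVec_map_mulVec (A : Matrix.unitaryGroup (Fin N) ℂ) :
    (gaussianVec N).map (fun x => (A : Matrix (Fin N) (Fin N) ℂ) *ᵥ x) = gaussianVec N := by
  have hm : Measurable fun x : Fin N → ℂ => (A : Matrix (Fin N) (Fin N) ℂ) *ᵥ x :=
    (Continuous.matrix_mulVec continuous_const continuous_id).measurable
  have ht : Measurable (WithLp.toLp 2 : (Fin N → ℂ) → PiLp 2 fun _ : Fin N => ℂ) := by fun_prop
  have key : ((gaussianVec N).map (fun x => (A : Matrix (Fin N) (Fin N) ℂ) *ᵥ x)).map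
      (WithLp.toLp 2) = (gaussianVec N).map (WithLp.toLp 2) := by
    have : IsProbabilityMeasure ((gaussianVec N).map
        (WithLp.toLp 2 : (Fin N → ℂ) → PiLp 2 fun _ : Fin N => ℂ)) :=
      Measure.isProbabilityMeasure_map ht.aemeasurable
    have : IsProbabilityMeasure ((gaussianVec N).map
        (fun x => (A : Matrix (Fin N) (Fin N) ℂ) *ᵥ x)) :=
      Measure.isProbabilityMeasure_map hm.aemeasurable
    have : IsProbabilityMeasure (((gaussianVec N).map
        (fun x => (A : Matrix (Fin N) (Fin N) ℂ) *ᵥ x)).map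
        (WithLp.toLp 2 : (Fin N → ℂ) → PiLp 2 fun _ : Fin N => ℂ)) :=
      Measure.isProbabilityMeasure_map ht.aemeasurable
    refine Measure.ext_of_charFun (E := PiLp 2 fun _ : Fin N => ℂ) ?_
    ext t
    have hin : ∀ v w : Fin N → ℂ, inner ℝ (WithLp.toLp 2 v : PiLp 2 fun _ : Fin N => ℂ)
        (WithLp.toLp 2 w) = (star v ⬝ᵥ w).re := fun v w => by
      simp [PiLp.inner_apply, dotProduct, Complex.inner, mul_comm]
    have h1 : charFun (((gaussianVec N).map
        (fun x => (A : Matrix (Fin N) (Fin N) ℂ) *ᵥ x)).map (WithLp.toLp 2)) t =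
        charFun ((gaussianVec N).map (WithLp.toLp 2))
          (WithLp.toLp 2 ((A : Matrix (Fin N) (Fin N) ℂ)ᴴ *ᵥ (WithLp.ofLp t)) :
            PiLp 2 fun _ : Fin N => ℂ) := by
      rw [charFun_apply, charFun_apply, integral_map ht.aemeasurable (by fun_prop),
        integral_map ht.aemeasurable (by fun_prop), integral_map hm.aemeasurable (by fun_prop)]
      refine integral_congr_ae (.of_forall fun x => ?_)
      have e : t = WithLp.toLp 2 (WithLp.ofLp t) := rfl
      beta_reduce
      rw [e, hin, hin, star_dotProduct_mulVec, Matrix.star_mulVec, ← Matrix.dotProduct_mulVec]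
      rw [Matrix.star_mulVec, Matrix.conjTranspose_conjTranspose, ← Matrix.dotProduct_mulVec]
    rw [h1, charFun_gaussianVec, charFun_gaussianVec]
    have h2 : nrm ((A : Matrix (Fin N) (Fin N) ℂ)ᴴ *ᵥ (WithLp.ofLp t)) = nrm (WithLp.ofLp t) :=
      nrm_mulVec A⁻¹ _
    have h3 : ‖(WithLp.toLp 2 ((A : Matrix (Fin N) (Fin N) ℂ)ᴴ *ᵥ (WithLp.ofLp t)) :
        PiLp 2 fun _ : Fin N => ℂ)‖ = ‖t‖ := h2
    rw [h3]
  have h := congrArg (fun ν => ν.map (WithLp.ofLp : (PiLp 2 fun _ : Fin N => ℂ) → _)) key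
  have ho : Measurable (WithLp.ofLp : (PiLp 2 fun _ : Fin N => ℂ) → Fin N → ℂ) := by fun_prop
  simp only [Measure.map_map ho ht] at h
  simpa [Function.comp_def] using h

end GaussianInvariance

/-! ### Uniform laws on spheres through normalised Gaussian vectors. -/

section Sphere

variable {N : ℕ}

/-- The vector in the direction of the component of `x` orthogonal to `w`, of norm `ρ`. -/
def perpDir (ρ : ℝ) (w x : Fin N → ℂ) : Fin N → ℂ := ((ρ / nrm (perp w x) : ℝ) : ℂ) • perp w x

lemma nrm_perpDir {ρ : ℝ} (hρ : 0 ≤ ρ) {w x : Fin N → ℂ} (hx : perp w x ≠ 0) :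
    nrm (perpDir ρ w x) = ρ := by
  have : nrm (perp w x) ≠ 0 := fun h => hx (nrm_eq_zero.1 h)
  rw [perpDir, nrm_smul, Complex.norm_real, Real.norm_eq_abs,
    abs_of_nonneg (div_nonneg hρ (nrm_nonneg _)), div_mul_cancel₀ _ this]

lemma perpDir_mulVec (A : Matrix.unitaryGroup (Fin N) ℂ) (ρ : ℝ) (w x : Fin N → ℂ) :
    perpDir ρ ((A : Matrix (Fin N) (Fin N) ℂ) *ᵥ w) ((A : Matrix (Fin N) (Fin N) ℂ) *ᵥ x) =
      (A : Matrix (Fin N) (Fin N) ℂ) *ᵥ perpDir ρ w x := by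
  rw [perpDir, perp_mulVec, nrm_mulVec, perpDir, Matrix.mulVec_smul]

lemma measurable_perpDir {α : Type*} [MeasurableSpace α] {ρ : α → ℝ} {f g : α → Fin N → ℂ}
    (hρ : Measurable ρ) (hf : Measurable f) (hg : Measurable g) :
    Measurable fun x => perpDir (ρ x) (f x) (g x) := by
  have hp := measurable_perp hf hg
  exact (Complex.measurable_ofReal.comp
    (hρ.div (continuous_nrm.measurable.comp hp))).smul hp

/-- A random vector obtained by letting the stabilizer of `w` act on a fixed vector orthogonal to
`w` is uniform on a sphere of `w⊥`, hence distributed as a normalized Gaussian vector. -/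
lemma measure_orbit_le {G : Type*} [Group G] [MeasurableSpace G] [MeasurableMul G]
    {η : Measure G} [IsProbabilityMeasure η] [η.IsMulLeftInvariant]
    (φ : G →* Matrix.unitaryGroup (Fin N) ℂ)
    (hφ : Measurable fun p : G × (Fin N → ℂ) =>
      (((φ p.1)⁻¹ : Matrix.unitaryGroup (Fin N) ℂ) : Matrix (Fin N) (Fin N) ℂ) *ᵥ p.2)
    {w v : Fin N → ℂ}
    (hw : ∀ g, (φ g : Matrix (Fin N) (Fin N) ℂ) *ᵥ w = w)
    (hsurj : ∀ A : Matrix.unitaryGroup (Fin N) ℂ,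
      (A : Matrix (Fin N) (Fin N) ℂ) *ᵥ w = w → ∃ g, φ g = A)
    (hv : star w ⬝ᵥ v = 0) {S : Set (Fin N → ℂ)} (hS : MeasurableSet S) :
    η {g | (((φ g)⁻¹ : Matrix.unitaryGroup (Fin N) ℂ) : Matrix (Fin N) (Fin N) ℂ) *ᵥ v ∈ S} ≤
      gaussianVec N {x | perp w x = 0 ∨ perpDir (nrm v) w x ∈ S} := by
  -- Adding the degenerate event `perp w x = 0` to the right-hand side gives an inequality that
  -- holds without computing its probability; `spectrumModel_tendsto` disposes of it asymptotically.
  set T : Set (Fin N → ℂ) := {x | perp w x = 0 ∨ perpDir (nrm v) w x ∈ S} with hT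
  have hTm : MeasurableSet T := by
    refine MeasurableSet.union ?_ ?_
    · exact measurable_perp measurable_const measurable_id (measurableSet_singleton 0)
    · exact measurable_perpDir measurable_const measurable_const measurable_id hS
  set R : Set (G × (Fin N → ℂ)) := {p | (((φ p.1)⁻¹ : Matrix.unitaryGroup (Fin N) ℂ) :
    Matrix (Fin N) (Fin N) ℂ) *ᵥ p.2 ∈ T} with hR
  have hRm : MeasurableSet R := hφ hTm
  have hinv : ∀ g, (((φ g)⁻¹ : Matrix.unitaryGroup (Fin N) ℂ) : Matrix (Fin N) (Fin N) ℂ) *ᵥ w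
      = w := fun g => by rw [← map_inv, hw]
  have hRT : ∀ g x, (g, x) ∈ R ↔ (perp w x = 0 ∨
      (((φ g)⁻¹ : Matrix.unitaryGroup (Fin N) ℂ) : Matrix (Fin N) (Fin N) ℂ) *ᵥ
        perpDir (nrm v) w x ∈ S) := fun g x => by
    have e1 := perp_mulVec (φ g)⁻¹ w x
    have e2 := perpDir_mulVec (φ g)⁻¹ (nrm v) w x
    rw [hinv] at e1 e2
    simp only [hR, hT, Set.mem_ofPred_eq]
    rw [e1, e2, ← nrm_eq_zero, nrm_mulVec, nrm_eq_zero]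
  have hle : ∀ x, η {g | (((φ g)⁻¹ : Matrix.unitaryGroup (Fin N) ℂ) :
      Matrix (Fin N) (Fin N) ℂ) *ᵥ v ∈ S} ≤ η {g | (g, x) ∈ R} := by
    intro x
    by_cases hx : perp w x = 0
    · have : {g | (g, x) ∈ R} = Set.univ := by
        ext g; simp [hRT, hx]
      rw [this]
      exact measure_mono (Set.subset_univ _)
    · have hperp : star w ⬝ᵥ perpDir (nrm v) w x = 0 := by
        rw [perpDir, dotProduct_smul, star_dotProduct_perp, smul_zero]
      obtain ⟨A, hAw, hAv⟩ := exists_unitary_mulVec_eq (nrm_perpDir (nrm_nonneg v) hx).symm hv hperp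
      obtain ⟨g₀, rfl⟩ := hsurj A hAw
      -- Here `g₀` carries `v` to `perpDir (nrm v) w x`. As `(g₀ g)⁻¹ = g⁻¹ g₀⁻¹`, moving the base
      -- point is a left translation of `g`, under which `η` is invariant.
      have hset : {g | (((φ g)⁻¹ : Matrix.unitaryGroup (Fin N) ℂ) :
          Matrix (Fin N) (Fin N) ℂ) *ᵥ v ∈ S} = (fun g => g₀ * g) ⁻¹'
          {g | (((φ g)⁻¹ : Matrix.unitaryGroup (Fin N) ℂ) : Matrix (Fin N) (Fin N) ℂ) *ᵥ
            perpDir (nrm v) w x ∈ S} := by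
        ext g
        simp only [Set.mem_ofPred_eq, Set.mem_preimage]
        rw [← hAv, map_mul, mul_inv_rev, Matrix.mulVec_mulVec, ← Matrix.UnitaryGroup.mul_val,
          inv_mul_cancel_right]
      rw [hset, measure_preimage_mul]
      exact measure_mono fun g hg => (hRT g x).2 (Or.inr hg)
  -- Average over a Gaussian `x` and exchange the integrals. For fixed `g`, unitary invariance of
  -- the Gaussian vector removes `g`.
  calc _ = ∫⁻ _ : Fin N → ℂ, η {g | (((φ g)⁻¹ : Matrix.unitaryGroup (Fin N) ℂ) :
        Matrix (Fin N) (Fin N) ℂ) *ᵥ v ∈ S} ∂gaussianVec N := by simp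
    _ ≤ ∫⁻ x, η {g | (g, x) ∈ R} ∂gaussianVec N := lintegral_mono hle
    _ = (η.prod (gaussianVec N)) R := (Measure.prod_apply_symm hRm).symm
    _ = ∫⁻ g, gaussianVec N {x | (g, x) ∈ R} ∂η := Measure.prod_apply hRm
    _ = ∫⁻ _ : G, gaussianVec N T ∂η := by
      refine lintegral_congr fun g => ?_
      have hmg : Measurable fun x : Fin N → ℂ => (((φ g)⁻¹ : Matrix.unitaryGroup (Fin N) ℂ) :
          Matrix (Fin N) (Fin N) ℂ) *ᵥ x :=
        (Continuous.matrix_mulVec continuous_const continuous_id).measurable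
      nth_rw 2 [← gaussianVec_map_mulVec (φ g)⁻¹]
      rw [Measure.map_apply hmg hTm]
      rfl
    _ = _ := by simp

end Sphere

/-! ### Comparison of the law of the spectrum with the Gaussian model. -/

section Representation

variable {N : ℕ}

lemma measurable_mulVec_unitary {α : Type*} [MeasurableSpace α]
    {A : α → Matrix.unitaryGroup (Fin N) ℂ} {v : α → Fin N → ℂ} (hA : Measurable A)
    (hv : Measurable v) : Measurable fun x => (A x : Matrix (Fin N) (Fin N) ℂ) *ᵥ v x := by
  have hc : Continuous fun p : Matrix.unitaryGroup (Fin N) ℂ × (Fin N → ℂ) =>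
      (p.1 : Matrix (Fin N) (Fin N) ℂ) *ᵥ p.2 :=
    (continuous_coe_unitaryGroup.comp continuous_fst).matrix_mulVec continuous_snd
  exact hc.measurable.comp (hA.prodMk hv)

/-- The unitary matrices which fix a vector. -/
def fixing (z : Fin N → ℂ) : Subgroup (Matrix.unitaryGroup (Fin N) ℂ) where
  carrier := {A | (A : Matrix (Fin N) (Fin N) ℂ) *ᵥ z = z}
  one_mem' := by simp
  mul_mem' {A B} hA hB := by
    simp only [Set.mem_ofPred_eq] at hA hB ⊢
    rw [Matrix.UnitaryGroup.mul_val, ← Matrix.mulVec_mulVec, hB, hA]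
  inv_mem' {A} hA := by
    simp only [Set.mem_ofPred_eq] at hA ⊢
    nth_rw 1 [← hA]
    exact conjTranspose_mulVec_mulVec A z

instance compactSpace_fixing (z : Fin N → ℂ) : CompactSpace (fixing z) := by
  refine isCompact_iff_compactSpace.1 (show IsCompact
    (fixing z : Set (Matrix.unitaryGroup (Fin N) ℂ)) from IsClosed.isCompact ?_)
  exact isClosed_eq (continuous_coe_unitaryGroup.matrix_mulVec continuous_const) continuous_const

/-- A variable with the law of the spectrum `V Q(Vᴴ z)` given `z`, in terms of the signal
`u = Vᴴ z` and a Gaussian vector `g`. -/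
def spectrumModel (Q : ℂ → ℂ) (u z g : Fin N → ℂ) : Fin N → ℂ :=
  coef u (fun k => Q (u k)) • z + perpDir (nrm (perp u fun k => Q (u k))) z g

lemma measurable_spectrumModel {Q : ℂ → ℂ} (hQ : Measurable Q) {α : Type*} [MeasurableSpace α]
    {u z g : α → Fin N → ℂ} (hu : Measurable u) (hz : Measurable z) (hg : Measurable g) :
    Measurable fun x => spectrumModel Q (u x) (z x) (g x) := by
  have hQu : Measurable fun x => fun k => Q (u x k) :=
    measurable_pi_iff.2 fun k => hQ.comp (measurable_pi_iff.1 hu k)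
  exact ((measurable_coef hu hQu).smul hz).add
    (measurable_perpDir (continuous_nrm.measurable.comp (measurable_perp hu hQu)) hz hg)

lemma measurable_spectrumVec {Q : ℂ → ℂ} (hQ : Measurable Q) {α : Type*} [MeasurableSpace α]
    {A : α → Matrix.unitaryGroup (Fin N) ℂ} {z : α → Fin N → ℂ} (hA : Measurable A)
    (hz : Measurable z) : Measurable fun x => spectrumVec Q (A x) (z x) := by
  refine measurable_mulVec_unitary hA ?_
  refine measurable_pi_iff.2 fun k => hQ.comp ?_
  exact measurable_pi_iff.1 (measurable_mulVec_unitary hA.inv hz) k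

/-- Two uses of `measure_orbit_le`. The stabilizer of `z` fixes the transmitted vector and
randomises the part of the spectrum orthogonal to `z` (Gaussian vector `p.2`); the full group then
randomises `u = Vᴴ z` on its sphere (Gaussian vector `p.1`). -/
lemma measure_spectrumVec_le {Q : ℂ → ℂ} (hQ : Measurable Q)
    {η : Measure (Matrix.unitaryGroup (Fin N) ℂ)} [IsProbabilityMeasure η]
    [η.IsMulLeftInvariant] (z : Fin N → ℂ) {S : Set (Fin N → ℂ)} (hS : MeasurableSet S) :
    η {A | spectrumVec Q A z ∈ S} ≤ ((gaussianVec N).prod (gaussianVec N))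
      {p | p.1 = 0 ∨ perp z p.2 = 0 ∨
        spectrumModel Q (((nrm z / nrm p.1 : ℝ) : ℂ) • p.1) z p.2 ∈ S} := by
  -- Normalising on the whole compact group `⊤` makes this a probability measure.
  let κ : Measure (fixing z) := Measure.haarMeasure ⊤
  have : IsProbabilityMeasure κ := ⟨Measure.haarMeasure_self⟩
  have hmK : ∀ {α : Type _} [MeasurableSpace α] {A : α → fixing z} {v : α → Fin N → ℂ},
      Measurable A → Measurable v → Measurable fun x =>
        (((A x)⁻¹ : Matrix.unitaryGroup (Fin N) ℂ) : Matrix (Fin N) (Fin N) ℂ) *ᵥ v x :=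
    fun hA hv => measurable_mulVec_unitary (measurable_subtype_coe.comp hA).inv hv
  -- averaging over the matrices which fix `z`
  have hstab : ∀ (B : fixing z) A, spectrumVec Q ((B : Matrix.unitaryGroup (Fin N) ℂ) * A) z =
      ((B : Matrix.unitaryGroup (Fin N) ℂ) : Matrix (Fin N) (Fin N) ℂ) *ᵥ spectrumVec Q A z := by
    intro B A
    have hB : ((B : Matrix.unitaryGroup (Fin N) ℂ) : Matrix (Fin N) (Fin N) ℂ)ᴴ *ᵥ z = z :=
      (B⁻¹).2
    have ht : transmitted Q ((B : Matrix.unitaryGroup (Fin N) ℂ) * A) z = transmitted Q A z := by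
      unfold transmitted
      rw [Matrix.UnitaryGroup.mul_val, Matrix.conjTranspose_mul, ← Matrix.mulVec_mulVec, hB]
    rw [spectrumVec, ht, Matrix.UnitaryGroup.mul_val, ← Matrix.mulVec_mulVec, spectrumVec]
  have h1 : ∀ B : fixing z, η {A | spectrumVec Q A z ∈ S} =
      η {A | (((B : Matrix.unitaryGroup (Fin N) ℂ)⁻¹ : Matrix.unitaryGroup (Fin N) ℂ) :
        Matrix (Fin N) (Fin N) ℂ) *ᵥ spectrumVec Q A z ∈ S} := by
    intro B
    rw [← measure_preimage_mul η (B : Matrix.unitaryGroup (Fin N) ℂ)⁻¹]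
    congr 1
    ext A
    exact Iff.of_eq (congrArg (· ∈ S) (hstab B⁻¹ A))
  set R : Set (Matrix.unitaryGroup (Fin N) ℂ × fixing z) :=
    {p | (((p.2 : Matrix.unitaryGroup (Fin N) ℂ)⁻¹ : Matrix.unitaryGroup (Fin N) ℂ) :
        Matrix (Fin N) (Fin N) ℂ) *ᵥ spectrumVec Q p.1 z ∈ S} with hR
  have hRm : MeasurableSet R :=
    hmK measurable_snd (measurable_spectrumVec hQ measurable_fst measurable_const) hS
  set u : Matrix.unitaryGroup (Fin N) ℂ → Fin N → ℂ := fun A =>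
    ((A⁻¹ : Matrix.unitaryGroup (Fin N) ℂ) : Matrix (Fin N) (Fin N) ℂ) *ᵥ z with hu
  have hum : Measurable u := measurable_mulVec_unitary measurable_id.inv measurable_const
  have h2 : ∀ A, κ {B | (A, B) ∈ R} ≤
      gaussianVec N {g | perp z g = 0 ∨ spectrumModel Q (u A) z g ∈ S} := by
    intro A
    set r := spectrumVec Q A z with hr
    have hrA : r = (A : Matrix (Fin N) (Fin N) ℂ) *ᵥ fun k => Q (u A k) := rfl
    have hzA : z = (A : Matrix (Fin N) (Fin N) ℂ) *ᵥ u A := by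
      have := conjTranspose_mulVec_mulVec A⁻¹ z
      rw [← Matrix.star_eq_conjTranspose, ← Matrix.UnitaryGroup.inv_val, inv_inv] at this
      exact this.symm
    -- Both `z` and `r` are images under `A`, of `u A` and `Q (u A)`; so the coefficient and the
    -- orthogonal length depend on `u A` only.
    have hc : coef z r = coef (u A) fun k => Q (u A k) := by
      rw [hrA]; nth_rw 1 [hzA]; exact coef_mulVec _ _ _
    have hp : nrm (perp z r) = nrm (perp (u A) fun k => Q (u A k)) := by
      rw [hrA]; nth_rw 1 [hzA]; rw [perp_mulVec, nrm_mulVec]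
    have hdec : r = coef z r • z + perp z r := by rw [perp]; abel
    have hS' : MeasurableSet {v | coef z r • z + v ∈ S} :=
      (measurable_const.add measurable_id) hS
    have := measure_orbit_le (η := κ) (fixing z).subtype
      (hmK measurable_fst measurable_snd) (w := z) (v := perp z r) (fun g => g.2)
      (fun B hB => ⟨⟨B, hB⟩, rfl⟩) (star_dotProduct_perp z r) hS'
    have e1 : {B | (A, B) ∈ R} = {B : fixing z | ((((fixing z).subtype B)⁻¹ :
        Matrix.unitaryGroup (Fin N) ℂ) : Matrix (Fin N) (Fin N) ℂ) *ᵥ perp z r ∈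
          {v | coef z r • z + v ∈ S}} := by
      ext B
      have hB : (((B : Matrix.unitaryGroup (Fin N) ℂ)⁻¹ : Matrix.unitaryGroup (Fin N) ℂ) :
          Matrix (Fin N) (Fin N) ℂ) *ᵥ z = z := (B⁻¹).2
      simp only [hR, Set.mem_ofPred_eq, ← hr]
      nth_rw 1 [hdec]
      rw [Matrix.mulVec_add, Matrix.mulVec_smul, hB]
      rfl
    rw [e1]
    refine this.trans_eq ?_
    rw [hc, hp]
    rfl
  -- the law of the signal
  set S' : (Fin N → ℂ) → Set (Fin N → ℂ) := fun g =>
    {v | perp z g = 0 ∨ spectrumModel Q v z g ∈ S} with hS'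
  have hS'm : MeasurableSet {p : (Fin N → ℂ) × (Fin N → ℂ) | p.1 ∈ S' p.2} := by
    refine MeasurableSet.union ?_ ?_
    · exact measurable_perp measurable_const measurable_snd (measurableSet_singleton 0)
    · exact measurable_spectrumModel hQ measurable_fst measurable_const measurable_snd hS
  have h3 : ∀ g, η {A | u A ∈ S' g} ≤
      gaussianVec N {h | h = 0 ∨ ((nrm z / nrm h : ℝ) : ℂ) • h ∈ S' g} := by
    intro g
    have := measure_orbit_le (η := η) (MonoidHom.id _)
      (measurable_mulVec_unitary measurable_fst.inv measurable_snd) (w := 0) (v := z) (by simp)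
      (fun A _ => ⟨A, rfl⟩) (by simp) (S := S' g)
      (hS'm.preimage (measurable_id.prodMk measurable_const))
    simp only [perpDir, perp_zero_left, MonoidHom.id_apply] at this
    exact this
  have hm4 : MeasurableSet {p : Matrix.unitaryGroup (Fin N) ℂ × (Fin N → ℂ) | u p.1 ∈ S' p.2} :=
    hS'm.preimage ((hum.comp measurable_fst).prodMk measurable_snd)
  have hm5 : MeasurableSet {p : (Fin N → ℂ) × (Fin N → ℂ) | p.1 = 0 ∨
      ((nrm z / nrm p.1 : ℝ) : ℂ) • p.1 ∈ S' p.2} := by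
    refine MeasurableSet.union (measurable_fst (measurableSet_singleton 0)) ?_
    refine hS'm.preimage (f := fun p : (Fin N → ℂ) × (Fin N → ℂ) => (((nrm z / nrm p.1 : ℝ) : ℂ) • p.1, p.2))
      (Measurable.prodMk ?_ measurable_snd)
    exact (Complex.measurable_ofReal.comp (measurable_const.div
      (continuous_nrm.measurable.comp measurable_fst))).smul measurable_fst
  calc _ = ∫⁻ _ : fixing z, η {A | spectrumVec Q A z ∈ S} ∂κ := by simp
    _ = ∫⁻ B, η {A | (A, B) ∈ R} ∂κ := lintegral_congr h1
    _ = (η.prod κ) R := (Measure.prod_apply_symm hRm).symm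
    _ = ∫⁻ A, κ {B | (A, B) ∈ R} ∂η := Measure.prod_apply hRm
    _ ≤ ∫⁻ A, gaussianVec N {g | u A ∈ S' g} ∂η := lintegral_mono h2
    _ = (η.prod (gaussianVec N)) {p | u p.1 ∈ S' p.2} := (Measure.prod_apply hm4).symm
    _ = ∫⁻ g, η {A | u A ∈ S' g} ∂gaussianVec N := Measure.prod_apply_symm hm4
    _ ≤ ∫⁻ g, gaussianVec N {h | h = 0 ∨ ((nrm z / nrm h : ℝ) : ℂ) • h ∈ S' g}
        ∂gaussianVec N := lintegral_mono h3
    _ = _ := (Measure.prod_apply_symm hm5).symm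

/-- The joint law of the spectrum and the symbols is controlled by that of the model. -/
lemma measure_prod_spectrumVec_le {Q : ℂ → ℂ} (hQ : Measurable Q)
    {η : Measure (Matrix.unitaryGroup (Fin N) ℂ)} [IsProbabilityMeasure η]
    [η.IsMulLeftInvariant] (ζ : Measure (Fin N → ℂ)) [IsProbabilityMeasure ζ]
    {S : Set ((Fin N → ℂ) × (Fin N → ℂ))} (hS : MeasurableSet S) :
    (η.prod ζ) {p | (spectrumVec Q p.1 p.2, p.2) ∈ S} ≤
      (ζ.prod ((gaussianVec N).prod (gaussianVec N)))
        {p | p.2.1 = 0 ∨ perp p.1 p.2.2 = 0 ∨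
          (spectrumModel Q (((nrm p.1 / nrm p.2.1 : ℝ) : ℂ) • p.2.1) p.1 p.2.2, p.1) ∈ S} := by
  have hm1 : MeasurableSet {p : Matrix.unitaryGroup (Fin N) ℂ × (Fin N → ℂ) |
      (spectrumVec Q p.1 p.2, p.2) ∈ S} :=
    hS.preimage ((measurable_spectrumVec hQ measurable_fst measurable_snd).prodMk measurable_snd)
  have hm2 : MeasurableSet {p : (Fin N → ℂ) × (Fin N → ℂ) × (Fin N → ℂ) | p.2.1 = 0 ∨
      perp p.1 p.2.2 = 0 ∨
      (spectrumModel Q (((nrm p.1 / nrm p.2.1 : ℝ) : ℂ) • p.2.1) p.1 p.2.2, p.1) ∈ S} := by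
    refine MeasurableSet.union (measurable_snd.fst (measurableSet_singleton 0))
      (MeasurableSet.union ?_ ?_)
    · exact measurable_perp measurable_fst measurable_snd.snd (measurableSet_singleton 0)
    · refine hS.preimage (Measurable.prodMk (measurable_spectrumModel hQ ?_ measurable_fst
        measurable_snd.snd) measurable_fst)
      exact (Complex.measurable_ofReal.comp ((continuous_nrm.measurable.comp measurable_fst).div
        (continuous_nrm.measurable.comp measurable_snd.fst))).smul measurable_snd.fst
  have : SFinite ((gaussianVec N).prod (gaussianVec N)) :=
    Measure.prod.instSFinite
  rw [Measure.prod_apply_symm hm1, Measure.prod_apply hm2]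
  refine lintegral_mono fun z => ?_
  exact measure_spectrumVec_le hQ z (S := {r | (r, z) ∈ S})
    (hS.preimage (measurable_id.prodMk measurable_const))

end Representation

/-! ### The normalised Euclidean norm. -/

section RootMeanSquare

variable {N : ℕ}

/-- The root mean square of the entries of a vector. -/
def rms (v : Fin N → ℂ) : ℝ := nrm v / √N

lemma rms_nonneg (v : Fin N → ℂ) : 0 ≤ rms v := div_nonneg (nrm_nonneg _) (Real.sqrt_nonneg _)

lemma rms_sq (v : Fin N → ℂ) : rms v ^ 2 = (1 / (N : ℝ)) * ∑ k, ‖v k‖ ^ 2 := by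
  rw [rms, div_pow, nrm_sq, Real.sq_sqrt (Nat.cast_nonneg _)]; ring

lemma rms_smul (c : ℂ) (v : Fin N → ℂ) : rms (c • v) = ‖c‖ * rms v := by
  rw [rms, nrm_smul, mul_div_assoc, rms]

lemma rms_add_le (v w : Fin N → ℂ) : rms (v + w) ≤ rms v + rms w := by
  rw [rms, rms, rms, ← add_div]
  exact div_le_div_of_nonneg_right (nrm_add_le v w) (Real.sqrt_nonneg _)

lemma abs_rms_sub_le (v w : Fin N → ℂ) : |rms v - rms w| ≤ rms (v - w) := by
  rw [rms, rms, rms, ← sub_div, abs_div, abs_of_nonneg (Real.sqrt_nonneg _)]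
  exact div_le_div_of_nonneg_right (abs_nrm_sub_le v w) (Real.sqrt_nonneg _)

lemma nrm_div_nrm (v w : Fin N → ℂ) : nrm v / nrm w = rms v / rms w := by
  rcases Nat.eq_zero_or_pos N with rfl | hN
  · have : ∀ x : Fin 0 → ℂ, nrm x = 0 := fun x => nrm_eq_zero.2 (Subsingleton.elim _ _)
    simp [this, rms]
  · have : √(N : ℝ) ≠ 0 := (Real.sqrt_pos.2 (by exact_mod_cast hN)).ne'
    rw [rms, rms, div_div_div_cancel_right₀ this]

lemma norm_dotProduct_div_le (v w : Fin N → ℂ) :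
    ‖(1 / (N : ℂ)) * (star v ⬝ᵥ w)‖ ≤ rms v * rms w := by
  rw [norm_mul, rms, rms, div_mul_div_comm, Real.mul_self_sqrt (Nat.cast_nonneg _)]
  simp only [one_div, norm_inv, Complex.norm_natCast]
  rw [← div_eq_inv_mul]
  exact div_le_div_of_nonneg_right (norm_star_dotProduct_le v w) (Nat.cast_nonneg _)

lemma dotProduct_self_div (v : Fin N → ℂ) :
    (1 / (N : ℂ)) * (star v ⬝ᵥ v) = ((rms v ^ 2 : ℝ) : ℂ) := by
  rw [star_dotProduct_self, rms, div_pow, Real.sq_sqrt (Nat.cast_nonneg _)]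
  push_cast
  ring

lemma rms_le_mul {v w : Fin N → ℂ} {c : ℝ} (hc : 0 ≤ c) (h : ∀ k, ‖v k‖ ≤ c * ‖w k‖) :
    rms v ≤ c * rms w := by
  refine (pow_le_pow_iff_left₀ (rms_nonneg _) (mul_nonneg hc (rms_nonneg _)) two_ne_zero).1 ?_
  rw [mul_pow, rms_sq, rms_sq, mul_left_comm, Finset.mul_sum _ _ (c ^ 2)]
  have hN : (0 : ℝ) ≤ 1 / N := by positivity
  refine mul_le_mul_of_nonneg_left (Finset.sum_le_sum fun k _ => ?_) hN
  rw [← mul_pow]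
  exact pow_le_pow_left₀ (norm_nonneg _) (h k) _

end RootMeanSquare

/-! ### Deterministic asymptotics of the model. -/

section ModelLimit

variable {ι : Type*} {l : Filter ι} {n : ι → ℕ}

lemma coef_tendsto (hn : Tendsto n l atTop) {z g : ∀ i, Fin (n i) → ℂ} {p : ℝ} (hp : 0 < p)
    (hz : Tendsto (fun i => rms (z i)) l (𝓝 √p)) {c : ℂ}
    (hzg : Tendsto (fun i => (1 / (n i : ℂ)) * (star (z i) ⬝ᵥ g i)) l (𝓝 ((p : ℂ) * c))) :
    Tendsto (fun i => coef (z i) (g i)) l (𝓝 c) := by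
  have hp' : (p : ℂ) ≠ 0 := by exact_mod_cast hp.ne'
  have h2 : Tendsto (fun i => (1 / (n i : ℂ)) * (star (z i) ⬝ᵥ z i)) l (𝓝 (p : ℂ)) := by
    simp_rw [dotProduct_self_div]
    have := (Complex.continuous_ofReal.tendsto _).comp (hz.pow 2)
    rwa [Real.sq_sqrt hp.le] at this
  have h3 := Tendsto.div hzg h2 hp'
  rw [mul_div_cancel_left₀ _ hp'] at h3
  refine h3.congr' ?_
  filter_upwards [hn.eventually_gt_atTop 0] with i hi
  have : (n i : ℂ) ≠ 0 := by exact_mod_cast hi.ne'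
  simp only [coef, Pi.div_apply]
  rw [mul_div_mul_left _ _ (by simpa using this)]

/-- Asymptotics of the model of the spectrum, along any filter. -/
lemma spectrumModel_tendsto (hn : Tendsto n l atTop) {Q : ℂ → ℂ} {K : NNReal}
    (hQ : LipschitzWith K Q) {z h g : ∀ i, Fin (n i) → ℂ} {p : ℝ} (hp : 0 < p) {α : ℂ} {s : ℝ}
    (hz : Tendsto (fun i => rms (z i)) l (𝓝 √p))
    (hh : Tendsto (fun i => rms (h i)) l (𝓝 1))
    (hg : Tendsto (fun i => rms (g i)) l (𝓝 1))
    (hzg : Tendsto (fun i => (1 / (n i : ℂ)) * (star (z i) ⬝ᵥ g i)) l (𝓝 0))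
    (hy : Tendsto (fun i => rms (fun k => Q ((√p : ℂ) * h i k) - α * ((√p : ℂ) * h i k))) l (𝓝 s))
    (hq : Tendsto (fun i => (1 / (n i : ℂ)) * (star ((√p : ℂ) • h i) ⬝ᵥ
      fun k => Q ((√p : ℂ) * h i k))) l (𝓝 (p * α))) :
    Tendsto (fun i => rms (spectrumModel Q (((nrm (z i) / nrm (h i) : ℝ) : ℂ) • h i) (z i) (g i) -
        (α • z i + (s : ℂ) • g i))) l (𝓝 0) ∧
      ∀ᶠ i in l, h i ≠ 0 ∧ perp (z i) (g i) ≠ 0 := by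
  have hp' : √p ≠ 0 := (Real.sqrt_pos.2 hp).ne'
  have hp'' : (√p : ℂ) ≠ 0 := by exact_mod_cast hp'
  set κ : ι → ℝ := fun i => nrm (z i) / nrm (h i) with hκ
  have hκt : Tendsto κ l (𝓝 √p) := by
    simp_rw [hκ, nrm_div_nrm]
    have := hz.div hh one_ne_zero
    rwa [div_one] at this
  have hκc : Tendsto (fun i => (κ i : ℂ)) l (𝓝 (√p : ℂ)) :=
    (Complex.continuous_ofReal.tendsto _).comp hκt
  set u : ∀ i, Fin (n i) → ℂ := fun i => (κ i : ℂ) • h i with hu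
  set Qu : ∀ i, Fin (n i) → ℂ := fun i k => Q (u i k) with hQu
  set Qh : ∀ i, Fin (n i) → ℂ := fun i k => Q ((√p : ℂ) * h i k) with hQh
  set y : ∀ i, Fin (n i) → ℂ := fun i k => Q ((√p : ℂ) * h i k) - α * ((√p : ℂ) * h i k) with hy'
  -- The Lipschitz property allows the random scale `κ` to be replaced by its limit `√p`.
  have hD : Tendsto (fun i => rms (Qu i - Qh i)) l (𝓝 0) := by
    have hle : ∀ i, rms (Qu i - Qh i) ≤ (K * |κ i - √p|) * rms (h i) := fun i => by
      refine rms_le_mul (by positivity) fun k => ?_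
      refine (hQ.norm_sub_le _ _).trans_eq ?_
      rw [hu]
      simp only [Pi.smul_apply, smul_eq_mul]
      rw [← sub_mul, norm_mul, ← Complex.ofReal_sub, Complex.norm_real, Real.norm_eq_abs, mul_assoc]
    have h0 : Tendsto (fun i => (K * |κ i - √p|) * rms (h i)) l (𝓝 0) := by
      have := ((hκt.sub_const √p).abs.const_mul (K : ℝ)).mul hh
      simpa using this
    exact squeeze_zero (fun i => rms_nonneg _) hle h0
  have hru : Tendsto (fun i => rms (u i)) l (𝓝 √p) := by
    simp_rw [hu, rms_smul]
    have := hκc.norm.mul hh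
    simpa [abs_of_nonneg (Real.sqrt_nonneg p)] using this
  have huQ : Tendsto (fun i => (1 / (n i : ℂ)) * (star (u i) ⬝ᵥ Qu i)) l (𝓝 (p * α)) := by
    have hdiff : Tendsto (fun i => (1 / (n i : ℂ)) * (star ((√p : ℂ) • h i) ⬝ᵥ (Qu i - Qh i))) l
        (𝓝 0) := by
      refine squeeze_zero_norm (fun i => norm_dotProduct_div_le _ _) ?_
      have hsm : Tendsto (fun i => rms ((√p : ℂ) • h i)) l (𝓝 (‖(√p : ℂ)‖ * 1)) := by
        simp_rw [rms_smul]; exact hh.const_mul _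
      simpa using hsm.mul hD
    have := (hκc.div_const (√p : ℂ)).mul (hq.add hdiff)
    rw [div_self hp'', one_mul, add_zero] at this
    refine this.congr fun i => ?_
    rw [← mul_add, ← dotProduct_add, add_sub_cancel, hu]
    simp only [star_smul, smul_dotProduct, smul_eq_mul]
    simp only [RCLike.star_def, Complex.conj_ofReal]
    field_simp
  have hc : Tendsto (fun i => coef (u i) (Qu i)) l (𝓝 α) := coef_tendsto hn hp hru huQ
  have hb : Tendsto (fun i => coef (z i) (g i)) l (𝓝 0) :=
    coef_tendsto hn hp hz (by simpa using hzg)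
  -- `perp u Qu - y = (Qu - Qh) + (α√p - coef u Qu · κ) h`, and both terms are small in root mean
  -- square.
  have hρ : Tendsto (fun i => rms (perp (u i) (Qu i))) l (𝓝 s) := by
    have h0 : Tendsto (fun i => rms (Qu i - Qh i) +
        ‖α * √p - coef (u i) (Qu i) * κ i‖ * rms (h i)) l (𝓝 0) := by
      have h1 : Tendsto (fun i => α * √p - coef (u i) (Qu i) * κ i) l (𝓝 (α * √p - α * √p)) :=
        tendsto_const_nhds.sub (hc.mul hκc)
      have := hD.add (h1.norm.mul hh)
      simpa using this
    have hle : ∀ i, ‖rms (perp (u i) (Qu i)) - rms (y i)‖ ≤ rms (Qu i - Qh i) +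
        ‖α * √p - coef (u i) (Qu i) * κ i‖ * rms (h i) := fun i => by
      rw [Real.norm_eq_abs]
      refine (abs_rms_sub_le _ _).trans ?_
      rw [← rms_smul]
      refine le_trans (le_of_eq ?_) (rms_add_le _ _)
      congr 1
      ext k
      simp only [perp, hy', hQh, hu, Pi.sub_apply, Pi.add_apply, Pi.smul_apply, smul_eq_mul]
      ring
    have := (squeeze_zero_norm hle h0).add hy
    rw [zero_add] at this
    exact this.congr fun i => sub_add_cancel _ _
  have hpg : Tendsto (fun i => rms (perp (z i) (g i))) l (𝓝 1) := by
    have h0 : Tendsto (fun i => ‖coef (z i) (g i)‖ * rms (z i)) l (𝓝 0) := by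
      simpa using hb.norm.mul hz
    have hle : ∀ i, ‖rms (perp (z i) (g i)) - rms (g i)‖ ≤ ‖coef (z i) (g i)‖ * rms (z i) :=
      fun i => by
      rw [Real.norm_eq_abs]
      refine (abs_rms_sub_le _ _).trans (le_of_eq ?_)
      rw [← norm_neg, ← rms_smul]
      congr 1
      ext k
      simp only [perp, Pi.sub_apply, Pi.smul_apply, smul_eq_mul]
      ring
    have := (squeeze_zero_norm hle h0).add hg
    simpa using this
  set t : ι → ℝ := fun i => nrm (perp (u i) (Qu i)) / nrm (perp (z i) (g i)) with ht
  have htt : Tendsto t l (𝓝 s) := by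
    simp_rw [ht, nrm_div_nrm]
    have := hρ.div hpg one_ne_zero
    rwa [div_one] at this
  have htc : Tendsto (fun i => (t i : ℂ)) l (𝓝 (s : ℂ)) :=
    (Complex.continuous_ofReal.tendsto _).comp htt
  refine ⟨?_, ?_⟩
  -- Expanding `perp z g`, the error is `(coef u Qu - α - t · coef z g) z + (t - s) g`.
  · have hle : ∀ i, rms (spectrumModel Q (u i) (z i) (g i) - (α • z i + (s : ℂ) • g i)) ≤
        ‖coef (u i) (Qu i) - α - t i * coef (z i) (g i)‖ * rms (z i) +
          ‖(t i : ℂ) - s‖ * rms (g i) := fun i => by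
      rw [← rms_smul, ← rms_smul]
      refine le_trans (le_of_eq ?_) (rms_add_le _ _)
      congr 1
      ext k
      simp only [spectrumModel, perpDir]
      change (coef (u i) (Qu i) • z i + (t i : ℂ) • perp (z i) (g i) - _ : Fin (n i) → ℂ) k = _
      simp only [perp, Pi.sub_apply, Pi.add_apply, Pi.smul_apply, smul_eq_mul]
      ring
    refine squeeze_zero (fun i => rms_nonneg _) hle ?_
    have h1 := ((hc.sub_const α).sub (htc.mul hb)).norm.mul hz
    have h2 := (htc.sub_const (s : ℂ)).norm.mul hg
    have := h1.add h2
    simpa using this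
  -- A root mean square close to `1` excludes the degenerate events.
  · filter_upwards [hh.eventually_ne one_ne_zero, hpg.eventually_ne one_ne_zero] with i h1 h2
    refine ⟨fun h => h1 ?_, fun h => h2 ?_⟩
    · rw [rms, nrm_eq_zero.2 h, zero_div]
    · rw [rms, nrm_eq_zero.2 h, zero_div]

end ModelLimit

/-! ### Stability of empirical averages under small mean-square perturbations. -/

section TestFunctions

/-- A modulus of continuity which is quadratic up to an arbitrarily small error. -/
def QuadraticModulus {E : Type*} [NormedAddCommGroup E] (f : E → ℝ) : Prop :=
  ∀ ε > 0, ∃ C, 0 ≤ C ∧ ∀ x y, |f x - f y| ≤ ε * (1 + ‖y‖ ^ 2) + C * ‖x - y‖ ^ 2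

lemma QuadraticModulus.abs_le {E : Type*} [NormedAddCommGroup E] {f : E → ℝ}
    (hf : QuadraticModulus f) : ∃ C, 0 ≤ C ∧ ∀ x, |f x| ≤ C * (1 + ‖x‖ ^ 2) := by
  obtain ⟨C, hC, h⟩ := hf 1 one_pos
  refine ⟨|f 0| + 1 + C, by positivity, fun x => ?_⟩
  have h1 := h x 0
  have h2 : |f x| ≤ |f x - f 0| + |f 0| := by
    have := abs_add_le (f x - f 0) (f 0)
    rwa [sub_add_cancel] at this
  simp only [norm_zero, sub_zero] at h1
  have := mul_nonneg (abs_nonneg (f 0)) (sq_nonneg ‖x‖)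
  nlinarith [sq_nonneg ‖x‖]

/-- Averaging the modulus bounds the difference by `ε'` times one plus the mean energy of `(r', z)`,
plus `C · rms (r - r')²`; closeness in root mean square suffices, with no control of single entries.
-/
lemma average_sub_tendsto {ι : Type*} {l : Filter ι} {n : ι → ℕ} {M : ℕ}
    (b : ∀ i, Fin (n i) → Fin M) (m : Fin M) {f : ℂ × ℂ → ℝ} (hf : QuadraticModulus f)
    {r r' z : ∀ i, Fin (n i) → ℂ} (hr : Tendsto (fun i => rms (r i - r' i)) l (𝓝 0)) {B : ℝ}
    (hr' : ∀ᶠ i in l, rms (r' i) ≤ B) (hz : ∀ᶠ i in l, rms (z i) ≤ B) :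
    Tendsto (fun i => (1 / (n i : ℝ)) * (∑ k, if b i k = m then f (r i k, z i k) else 0) -
      (1 / (n i : ℝ)) * ∑ k, if b i k = m then f (r' i k, z i k) else 0) l (𝓝 0) := by
  refine Metric.tendsto_nhds.2 fun ε hε => ?_
  -- Chosen so that `ε' (1 + B² + B²) = ε / 2`.
  set ε' := ε / (2 * (1 + 2 * B ^ 2)) with hε'
  have hε'0 : 0 < ε' := by positivity
  obtain ⟨C, hC, h⟩ := hf ε' hε'0
  have h0 : Tendsto (fun i => C * rms (r i - r' i) ^ 2) l (𝓝 0) := by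
    simpa using (hr.pow 2).const_mul C
  filter_upwards [hr', hz, h0.eventually_lt_const (half_pos hε)] with i h1 h2 h3
  rw [dist_zero_right, Real.norm_eq_abs, ← mul_sub, ← Finset.sum_sub_distrib, abs_mul,
    abs_of_nonneg (by positivity : 0 ≤ 1 / (n i : ℝ))]
  have hterm : ∀ k, |(if b i k = m then f (r i k, z i k) else 0) -
      (if b i k = m then f (r' i k, z i k) else 0)| ≤
      ε' * (1 + (‖r' i k‖ ^ 2 + ‖z i k‖ ^ 2)) + C * ‖(r i - r' i) k‖ ^ 2 := fun k => by
    split_ifs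
    · refine (h _ _).trans ?_
      have e1 : ‖((r i k, z i k) : ℂ × ℂ) - (r' i k, z i k)‖ = ‖(r i - r' i) k‖ := by
        simp [Prod.norm_def]
      have e2 : ‖((r' i k, z i k) : ℂ × ℂ)‖ ^ 2 ≤ ‖r' i k‖ ^ 2 + ‖z i k‖ ^ 2 := by
        rw [Prod.norm_def]
        rcases max_cases ‖r' i k‖ ‖z i k‖ with h | h <;> simp only [h.1] <;> nlinarith
      rw [e1]
      gcongr
    · simp only [sub_self, abs_zero]; positivity
  calc _ ≤ (1 / (n i : ℝ)) * ∑ k, (ε' * (1 + (‖r' i k‖ ^ 2 + ‖z i k‖ ^ 2)) +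
        C * ‖(r i - r' i) k‖ ^ 2) := by
        refine mul_le_mul_of_nonneg_left ?_ (by positivity)
        exact (Finset.abs_sum_le_sum_abs _ _).trans (Finset.sum_le_sum fun k _ => hterm k)
    _ = ε' * ((1 / (n i : ℝ)) * n i + (rms (r' i) ^ 2 + rms (z i) ^ 2)) +
        C * rms (r i - r' i) ^ 2 := by
        rw [rms_sq, rms_sq, rms_sq]
        simp only [Finset.sum_add_distrib, ← Finset.mul_sum, Finset.sum_const, Finset.card_univ,
          Fintype.card_fin, nsmul_eq_mul]
        ring
    _ ≤ ε' * (1 + (B ^ 2 + B ^ 2)) + C * rms (r i - r' i) ^ 2 := by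
        have e1 : (1 / (n i : ℝ)) * n i ≤ 1 := by
          rw [one_div, mul_comm]; exact mul_inv_le_one
        have e2 := pow_le_pow_left₀ (rms_nonneg _) h1 2
        have e3 := pow_le_pow_left₀ (rms_nonneg _) h2 2
        gcongr
    _ < ε / 2 + ε / 2 := by
        refine add_lt_add_of_le_of_lt (le_of_eq ?_) h3
        rw [hε']; field_simp; ring
    _ = ε := add_halves ε

end TestFunctions

/-! ### Integrability of quadratic expressions. -/

section Moments

variable {Ω : Type*} [MeasurableSpace Ω] {μ : Measure Ω}

/-- The law of large numbers asks for fourth moments of its summands, which here are quadratic;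
hence the eighth moments of the entries. -/
lemma memLp_four_norm_sq {F : Ω → ℂ} (hF : MemLp F 8 μ) : MemLp (fun ω => ‖F ω‖ ^ 2) 4 μ := by
  have h := hF.norm_rpow_div 2
  have e : (8 : ℝ≥0∞) / 2 = 4 := by
    rw [show (8 : ℝ≥0∞) = 4 * 2 by norm_num,
      ENNReal.mul_div_cancel_right (by norm_num) (by norm_num)]
  rw [e] at h
  simpa using h

lemma memLp_four_conj_mul {F G : Ω → ℂ} (hF : MemLp F 8 μ) (hG : MemLp G 8 μ) :
    MemLp (fun ω => conj (F ω) * G ω) 4 μ := by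
  refine ((memLp_four_norm_sq hF).add (memLp_four_norm_sq hG)).mono
    ((Complex.continuous_conj.comp_aestronglyMeasurable hF.1).mul hG.1) (.of_forall fun ω => ?_)
  simp only [norm_mul, RCLike.norm_conj, Pi.add_apply, Real.norm_eq_abs]
  refine le_trans ?_ (le_abs_self _)
  nlinarith [sq_nonneg (‖F ω‖ - ‖G ω‖), sq_nonneg (‖F ω‖), sq_nonneg ‖G ω‖]

lemma memLp_comp_lipschitz [IsFiniteMeasure μ] {p : ℝ≥0∞} {Q : ℂ → ℂ} {K : NNReal}
    (hQ : LipschitzWith K Q) {F : Ω → ℂ} (hF : MemLp F p μ) : MemLp (fun ω => Q (F ω)) p μ := by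
  have h1 := (memLp_const (μ := μ) (p := p) ‖Q 0‖).add (hF.norm.const_mul (K : ℝ))
  refine h1.mono (hQ.continuous.comp_aestronglyMeasurable hF.1) (.of_forall fun ω => ?_)
  refine le_trans ?_ (le_abs_self _)
  simp only [Pi.add_apply]
  have h2 := hQ.norm_sub_le (F ω) 0
  have h3 := norm_add_le (Q (F ω) - Q 0) (Q 0)
  rw [sub_add_cancel] at h3
  rw [sub_zero] at h2
  linarith

lemma integral_comp_of_measurePreserving {Y E : Type*} [MeasurableSpace Y] {ν : Measure Y}
    [NormedAddCommGroup E] [NormedSpace ℝ E] {T : Ω → Y} (hT : MeasurePreserving T μ ν) {F : Y → E}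
    (hF : AEStronglyMeasurable F ν) : ∫ ω, F (T ω) ∂μ = ∫ y, F y ∂ν := by
  rw [← hT.map_eq, integral_map hT.measurable.aemeasurable (by rwa [hT.map_eq])]

end Moments

/-! ### Laws of large numbers in the Gaussian model. -/

section Model

/-- The joint law of a symbol and of the two standard variables which drive the model. -/
def modelLaw (p : ℝ) : Measure (ℂ × ℂ × ℂ) :=
  (complexGaussian p).prod ((complexGaussian 1).prod (complexGaussian 1))

/-- The law of `(α Z + W, Z)` with `Z ∼ CN(0, p)` and `W ∼ CN(0, v)` independent. -/
def bandLaw (α : ℂ) (v p : ℝ) : Measure (ℂ × ℂ) :=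
  ((complexGaussian p).prod (complexGaussian v)).map fun q => (α * q.1 + q.2, q.1)

instance isProbabilityMeasure_modelLaw (p : ℝ) : IsProbabilityMeasure (modelLaw p) :=
  inferInstanceAs (IsProbabilityMeasure
    ((complexGaussian p).prod ((complexGaussian 1).prod (complexGaussian 1))))

lemma measurePreserving_modelLaw_symbol (p : ℝ) :
    MeasurePreserving (fun q : ℂ × ℂ × ℂ => q.1) (modelLaw p) (complexGaussian p) :=
  measurePreserving_fst

lemma measurePreserving_modelLaw_signal (p : ℝ) :
    MeasurePreserving (fun q : ℂ × ℂ × ℂ => q.2.1) (modelLaw p) (complexGaussian 1) :=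
  measurePreserving_fst.comp (measurePreserving_snd
    (μ := complexGaussian p) (ν := (complexGaussian 1).prod (complexGaussian 1)))

lemma measurePreserving_modelLaw_noise (p : ℝ) :
    MeasurePreserving (fun q : ℂ × ℂ × ℂ => q.2.2) (modelLaw p) (complexGaussian 1) :=
  measurePreserving_snd.comp (measurePreserving_snd
    (μ := complexGaussian p) (ν := (complexGaussian 1).prod (complexGaussian 1)))

lemma measurePreserving_modelLaw_pair (p : ℝ) :
    MeasurePreserving (fun q : ℂ × ℂ × ℂ => (q.1, q.2.2)) (modelLaw p)
      ((complexGaussian p).prod (complexGaussian 1)) :=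
  (MeasurePreserving.id _).prod measurePreserving_snd

lemma measurePreserving_ofReal_mul {v : ℝ} (hv : 0 ≤ v) (s : ℝ) :
    MeasurePreserving (fun g : ℂ => (s : ℂ) * g) (complexGaussian v) (complexGaussian (s ^ 2 * v)) :=
  ⟨by fun_prop, complexGaussian_map_ofReal_mul s v hv⟩

lemma measurePreserving_bandLaw (α : ℂ) (s p : ℝ) :
    MeasurePreserving (fun q : ℂ × ℂ × ℂ => (α * q.1 + (s : ℂ) * q.2.2, q.1)) (modelLaw p)
      (bandLaw α (s ^ 2) p) := by
  have h1 : MeasurePreserving (fun q : ℂ × ℂ => (α * q.1 + q.2, q.1))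
      ((complexGaussian p).prod (complexGaussian (s ^ 2))) (bandLaw α (s ^ 2) p) :=
    ⟨by fun_prop, rfl⟩
  have h2 := measurePreserving_ofReal_mul zero_le_one s
  rw [mul_one] at h2
  exact h1.comp (((MeasurePreserving.id _).prod h2).comp (measurePreserving_modelLaw_pair p))

lemma memLp_id_complexGaussian_eight (v : ℝ) : MemLp (fun u : ℂ => u) 8 (complexGaussian v) := by
  exact_mod_cast memLp_id_complexGaussian v 8

lemma memLp_symbol (p : ℝ) : MemLp (fun q : ℂ × ℂ × ℂ => q.1) 8 (modelLaw p) :=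
  (memLp_id_complexGaussian_eight p).comp_measurePreserving (measurePreserving_modelLaw_symbol p)

lemma memLp_signal (p : ℝ) : MemLp (fun q : ℂ × ℂ × ℂ => q.2.1) 8 (modelLaw p) :=
  (memLp_id_complexGaussian_eight 1).comp_measurePreserving (measurePreserving_modelLaw_signal p)

lemma memLp_noise (p : ℝ) : MemLp (fun q : ℂ × ℂ × ℂ => q.2.2) 8 (modelLaw p) :=
  (memLp_id_complexGaussian_eight 1).comp_measurePreserving (measurePreserving_modelLaw_noise p)

lemma integral_symbol_norm_sq {p : ℝ} (hp : 0 ≤ p) : ∫ q, ‖q.1‖ ^ 2 ∂modelLaw p = p := by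
  rw [integral_comp_of_measurePreserving (measurePreserving_modelLaw_symbol p)
    (F := fun u : ℂ => ‖u‖ ^ 2) (by fun_prop), integral_norm_sq_complexGaussian hp]

lemma integral_noise_norm_sq (p : ℝ) : ∫ q, ‖q.2.2‖ ^ 2 ∂modelLaw p = 1 := by
  rw [integral_comp_of_measurePreserving (measurePreserving_modelLaw_noise p)
    (F := fun u : ℂ => ‖u‖ ^ 2) (by fun_prop), integral_norm_sq_complexGaussian zero_le_one]

lemma integral_signal_norm_sq (p : ℝ) : ∫ q, ‖q.2.1‖ ^ 2 ∂modelLaw p = 1 := by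
  rw [integral_comp_of_measurePreserving (measurePreserving_modelLaw_signal p)
    (F := fun u : ℂ => ‖u‖ ^ 2) (by fun_prop), integral_norm_sq_complexGaussian zero_le_one]

lemma integral_conj_symbol_mul_noise (p : ℝ) : ∫ q, conj q.1 * q.2.2 ∂modelLaw p = 0 := by
  rw [integral_comp_of_measurePreserving (measurePreserving_modelLaw_pair p)
    (F := fun q : ℂ × ℂ => conj q.1 * q.2)
    ((Complex.continuous_conj.comp continuous_fst).mul continuous_snd).aestronglyMeasurable,
    integral_prod_mul (fun z : ℂ => conj z) (fun z : ℂ => z), integral_id_complexGaussian, mul_zero]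

lemma measurePreserving_scaled_signal {p₀ : ℝ} (hp₀ : 0 ≤ p₀) (p : ℝ) :
    MeasurePreserving (fun q : ℂ × ℂ × ℂ => (√p₀ : ℂ) * q.2.1) (modelLaw p)
      (complexGaussian p₀) := by
  have h := measurePreserving_ofReal_mul zero_le_one √p₀
  rw [mul_one, Real.sq_sqrt hp₀] at h
  exact h.comp (measurePreserving_modelLaw_signal p)

lemma integral_scaled_signal {p₀ : ℝ} (hp₀ : 0 ≤ p₀) (p : ℝ) {E : Type*} [NormedAddCommGroup E]
    [NormedSpace ℝ E] [SecondCountableTopology E] {F : ℂ → E} (hF : Continuous F) :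
    ∫ q, F ((√p₀ : ℂ) * q.2.1) ∂modelLaw p = ∫ u, F u ∂complexGaussian p₀ :=
  integral_comp_of_measurePreserving (measurePreserving_scaled_signal hp₀ p)
    hF.aestronglyMeasurable

lemma sum_bandFraction {M N : ℕ} (hN : 0 < N) (a : Fin N → Fin M) : ∑ m, bandFraction a m = 1 := by
  have := sum_band_eq a fun _ => (1 : ℝ)
  simp only [mul_one] at this
  rw [← this]
  have : (N : ℝ) ≠ 0 := by exact_mod_cast hN.ne'
  simp [this]

variable {M : ℕ} {P : Fin M → ℝ} {a : (N : ℕ) → Fin N → Fin M} {δ : Fin M → ℝ}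

lemma sum_limit_eq_one (hδ : ∀ m, Tendsto (fun N => bandFraction (a N) m) atTop (𝓝 (δ m))) :
    ∑ m, δ m = 1 := by
  refine tendsto_nhds_unique (tendsto_finsetSum Finset.univ fun m _ => hδ m) ?_
  refine tendsto_const_nhds.congr' ?_
  filter_upwards [eventually_gt_atTop 0] with N hN
  exact (sum_bandFraction hN _).symm

lemma limit_nonneg (hδ : ∀ m, Tendsto (fun N => bandFraction (a N) m) atTop (𝓝 (δ m)))
    (m : Fin M) : 0 ≤ δ m :=
  ge_of_tendsto' (hδ m) fun N => mul_nonneg (by positivity)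
    (Finset.sum_nonneg fun k _ => by split_ifs <;> norm_num)

/-- The sequence of laws on which the model lives. -/
def modelMeasure (P : Fin M → ℝ) (a : (N : ℕ) → Fin N → Fin M) (N : ℕ) :
    Measure (Fin N → ℂ × ℂ × ℂ) := Measure.pi fun k => modelLaw (P (a N k))

instance isProbabilityMeasure_modelMeasure (N : ℕ) :
    IsProbabilityMeasure (modelMeasure P a N) :=
  inferInstanceAs (IsProbabilityMeasure (Measure.pi fun k => modelLaw (P (a N k))))

lemma tendsto_rms_of_average {ι : Type*} {l : Filter ι} {n : ι → ℕ} {v : ∀ i, Fin (n i) → ℂ} {c : ℝ}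
    (h : Tendsto (fun i => (1 / (n i : ℝ)) * ∑ k, ‖v i k‖ ^ 2) l (𝓝 c)) :
    Tendsto (fun i => rms (v i)) l (𝓝 √c) := by
  refine ((Real.continuous_sqrt.tendsto _).comp h).congr fun i => ?_
  simp only [Function.comp]
  rw [← rms_sq, Real.sqrt_sq (rms_nonneg _)]

/-- The model of the spectrum, as a function of the driving variables. -/
def modelSpectrum (Q : ℂ → ℂ) {N : ℕ} (ω : Fin N → ℂ × ℂ × ℂ) : Fin N → ℂ :=
  spectrumModel Q (((nrm (fun k => (ω k).1) / nrm (fun k => (ω k).2.1) : ℝ) : ℂ) •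
    fun k => (ω k).2.1) (fun k => (ω k).1) fun k => (ω k).2.2

lemma distortion_mul_nonneg (Q : ℂ → ℂ) {p : ℝ} (hp : 0 < p) : 0 ≤ distortion Q p * p := by
  refine mul_nonneg (mul_nonneg (by positivity) ?_) hp.le
  exact integral_nonneg fun _ => by positivity

/-- The law of large numbers supplies each hypothesis of `spectrumModel_tendsto`. The symbols have
mean power `∑ δₘ Pₘ`, while `h` and `g` have the same law in every sub-band, so there only `∑ δₘ =
1` matters. -/
lemma modelSpectrum_tendsto (hP : ∀ m, 0 ≤ P m)
    (hδ : ∀ m, Tendsto (fun N => bandFraction (a N) m) atTop (𝓝 (δ m)))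
    (hpos : 0 < avgPower δ P) {Q : ℂ → ℂ} {K : NNReal} (hQ : LipschitzWith K Q) :
    Tendsto (fun x : Σ N, (Fin N → ℂ × ℂ × ℂ) => rms (fun k => (x.2 k).1))
        (summableFilter (modelMeasure P a)) (𝓝 √(avgPower δ P)) ∧
      Tendsto (fun x : Σ N, (Fin N → ℂ × ℂ × ℂ) => rms (fun k => (x.2 k).2.2))
        (summableFilter (modelMeasure P a)) (𝓝 1) ∧
      Tendsto (fun x : Σ N, (Fin N → ℂ × ℂ × ℂ) => rms (modelSpectrum Q x.2 -
        (gain Q (avgPower δ P) • (fun k => (x.2 k).1) +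
          (√(distortion Q (avgPower δ P) * avgPower δ P) : ℂ) • fun k => (x.2 k).2.2)))
        (summableFilter (modelMeasure P a)) (𝓝 0) ∧
      ∀ᶠ x : Σ N, (Fin N → ℂ × ℂ × ℂ) in summableFilter (modelMeasure P a),
        (fun k => (x.2 k).2.1) ≠ 0 ∧ perp (fun k => (x.2 k).1) (fun k => (x.2 k).2.2) ≠ 0 := by
  set p := avgPower δ P with hp
  set α := gain Q p with hα
  set s := √(distortion Q p * p) with hs
  have hpc : (p : ℂ) ≠ 0 := by exact_mod_cast hpos.ne'
  have hsum := sum_limit_eq_one hδ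
  have hz : Tendsto (fun x : Σ N, (Fin N → ℂ × ℂ × ℂ) => rms (fun k => (x.2 k).1))
      (summableFilter (modelMeasure P a)) (𝓝 √p) := by
    refine tendsto_rms_of_average ?_
    have h := tendsto_average (lam := fun m => modelLaw (P m)) hδ (fun _ q => ‖q.1‖ ^ 2)
      fun m => memLp_four_norm_sq (memLp_symbol (P m))
    simp_rw [integral_symbol_norm_sq (hP _)] at h
    exact h
  have hh : Tendsto (fun x : Σ N, (Fin N → ℂ × ℂ × ℂ) => rms (fun k => (x.2 k).2.1))
      (summableFilter (modelMeasure P a)) (𝓝 1) := by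
    rw [← Real.sqrt_one]
    refine tendsto_rms_of_average ?_
    have h := tendsto_average (lam := fun m => modelLaw (P m)) hδ (fun _ q => ‖q.2.1‖ ^ 2)
      fun m => memLp_four_norm_sq (memLp_signal (P m))
    simp_rw [integral_signal_norm_sq, mul_one, hsum] at h
    exact h
  have hg : Tendsto (fun x : Σ N, (Fin N → ℂ × ℂ × ℂ) => rms (fun k => (x.2 k).2.2))
      (summableFilter (modelMeasure P a)) (𝓝 1) := by
    rw [← Real.sqrt_one]
    refine tendsto_rms_of_average ?_
    have h := tendsto_average (lam := fun m => modelLaw (P m)) hδ (fun _ q => ‖q.2.2‖ ^ 2)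
      fun m => memLp_four_norm_sq (memLp_noise (P m))
    simp_rw [integral_noise_norm_sq, mul_one, hsum] at h
    exact h
  have hzg : Tendsto (fun x : Σ N, (Fin N → ℂ × ℂ × ℂ) => (1 / (x.1 : ℂ)) *
      (star (fun k => (x.2 k).1) ⬝ᵥ fun k => (x.2 k).2.2))
      (summableFilter (modelMeasure P a)) (𝓝 0) := by
    have h := tendsto_average_complex (lam := fun m => modelLaw (P m)) hδ
      (fun _ q => conj q.1 * q.2.2) fun m => memLp_four_conj_mul (memLp_symbol _) (memLp_noise _)
    simp_rw [integral_conj_symbol_mul_noise, mul_zero, Finset.sum_const_zero] at h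
    exact h
  have hsig : ∀ m, MemLp (fun q : ℂ × ℂ × ℂ => (√p : ℂ) * q.2.1) 8 (modelLaw (P m)) :=
    fun m => (memLp_signal _).const_mul _
  have hy : Tendsto (fun x : Σ N, (Fin N → ℂ × ℂ × ℂ) => rms (fun k =>
      Q ((√p : ℂ) * (x.2 k).2.1) - α * ((√p : ℂ) * (x.2 k).2.1)))
      (summableFilter (modelMeasure P a)) (𝓝 s) := by
    refine tendsto_rms_of_average ?_
    have h := tendsto_average (lam := fun m => modelLaw (P m)) hδ
      (fun _ q => ‖Q ((√p : ℂ) * q.2.1) - α * ((√p : ℂ) * q.2.1)‖ ^ 2)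
      fun m => memLp_four_norm_sq
        ((memLp_comp_lipschitz hQ (hsig m)).sub ((hsig m).const_mul α))
    have hcont : Continuous fun u : ℂ => ‖Q u - α * u‖ ^ 2 := by
      have := hQ.continuous
      fun_prop
    simp_rw [integral_scaled_signal hpos.le _ hcont, ← Finset.sum_mul, hsum, one_mul] at h
    have e : ∫ u, ‖Q u - α * u‖ ^ 2 ∂complexGaussian p = distortion Q p * p := by
      rw [distortion, ← hα]; field_simp
    rwa [e] at h
  have hq : Tendsto (fun x : Σ N, (Fin N → ℂ × ℂ × ℂ) => (1 / (x.1 : ℂ)) *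
      (star ((√p : ℂ) • fun k => (x.2 k).2.1) ⬝ᵥ fun k => Q ((√p : ℂ) * (x.2 k).2.1)))
      (summableFilter (modelMeasure P a)) (𝓝 (p * α)) := by
    have h := tendsto_average_complex (lam := fun m => modelLaw (P m)) hδ
      (fun _ q => conj ((√p : ℂ) * q.2.1) * Q ((√p : ℂ) * q.2.1))
      fun m => memLp_four_conj_mul (hsig m) (memLp_comp_lipschitz hQ (hsig m))
    have hcont : Continuous fun u : ℂ => conj u * Q u :=
      Complex.continuous_conj.mul hQ.continuous
    simp_rw [integral_scaled_signal hpos.le _ hcont, ← Finset.sum_mul, ← Complex.ofReal_sum, hsum,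
      Complex.ofReal_one, one_mul] at h
    have e : ∫ u, conj u * Q u ∂complexGaussian p = p * α := by
      rw [hα, gain]; field_simp
    rw [e] at h
    exact h
  exact ⟨hz, hg, spectrumModel_tendsto tendsto_fst_summableFilter hQ hpos hz hh hg hzg hy hq⟩

/-- The empirical averages of the model over a sub-band. -/
lemma modelSpectrum_average_tendsto (hP : ∀ m, 0 ≤ P m)
    (hδ : ∀ m, Tendsto (fun N => bandFraction (a N) m) atTop (𝓝 (δ m)))
    (hpos : 0 < avgPower δ P) {Q : ℂ → ℂ} {K : NNReal} (hQ : LipschitzWith K Q) (m : Fin M)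
    {f : ℂ × ℂ → ℝ} (hf : Continuous f) (hf' : QuadraticModulus f) :
    Tendsto (fun x : Σ N, (Fin N → ℂ × ℂ × ℂ) => (1 / (x.1 : ℝ)) *
      ∑ k, if a x.1 k = m then f (modelSpectrum Q x.2 k, (x.2 k).1) else 0)
      (summableFilter (modelMeasure P a))
      (𝓝 (δ m * ∫ y, f y ∂bandLaw (gain Q (avgPower δ P))
        (distortion Q (avgPower δ P) * avgPower δ P) (P m))) := by
  obtain ⟨hz, hg, hr, -⟩ := modelSpectrum_tendsto hP hδ hpos hQ
  set p := avgPower δ P with hp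
  set α := gain Q p with hα
  set s := √(distortion Q p * p) with hs
  have hs2 : distortion Q p * p = s ^ 2 := (Real.sq_sqrt (distortion_mul_nonneg Q hpos)).symm
  obtain ⟨C, hC, hle⟩ := hf'.abs_le
  have hmem : ∀ m', MemLp (fun q : ℂ × ℂ × ℂ => f (α * q.1 + (s : ℂ) * q.2.2, q.1)) 4
      (modelLaw (P m')) := fun m' => by
    have h1 : MemLp (fun q : ℂ × ℂ × ℂ => α * q.1 + (s : ℂ) * q.2.2) 8 (modelLaw (P m')) :=
      ((memLp_symbol _).const_mul α).add ((memLp_noise _).const_mul _)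
    have h2 := ((memLp_const (1 : ℝ)).add ((memLp_four_norm_sq h1).add
      (memLp_four_norm_sq (memLp_symbol (P m'))))).const_mul C
    refine h2.mono (by fun_prop) (.of_forall fun q => ?_)
    refine (hle _).trans ((mul_le_mul_of_nonneg_left ?_ hC).trans (le_abs_self _))
    simp only [Pi.add_apply]
    refine add_le_add_right ?_ _
    rw [Prod.norm_def]
    rcases max_cases ‖α * q.1 + (s : ℂ) * q.2.2‖ ‖q.1‖ with h | h <;>
      simp only [h.1] <;> nlinarith [sq_nonneg ‖α * q.1 + (s : ℂ) * q.2.2‖, sq_nonneg ‖q.1‖]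
  -- The restriction to sub-band `m` is absorbed into a test function depending on the label.
  have h1 := tendsto_average (lam := fun m => modelLaw (P m)) hδ
    (fun m' q => if m' = m then f (α * q.1 + (s : ℂ) * q.2.2, q.1) else 0) fun m' => by
      by_cases h : m' = m
      · simpa [h] using hmem m
      · simp [h]
  have e : ∑ m', δ m' * ∫ q, (if m' = m then f (α * q.1 + (s : ℂ) * q.2.2, q.1) else 0)
      ∂modelLaw (P m') = δ m * ∫ y, f y ∂bandLaw α (s ^ 2) (P m) := by
    rw [Finset.sum_eq_single m]
    · rw [← integral_comp_of_measurePreserving (measurePreserving_bandLaw α s (P m))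
        hf.aestronglyMeasurable]
      simp
    · intro m' _ hm'
      simp [hm']
    · simp
  rw [e] at h1
  rw [hs2]
  have hr' : Tendsto (fun x : Σ N, (Fin N → ℂ × ℂ × ℂ) => ‖α‖ * rms (fun k => (x.2 k).1) +
      ‖(s : ℂ)‖ * rms (fun k => (x.2 k).2.2)) (summableFilter (modelMeasure P a))
      (𝓝 (‖α‖ * √p + ‖(s : ℂ)‖ * 1)) := (hz.const_mul _).add (hg.const_mul _)
  have h2 := average_sub_tendsto (l := summableFilter (modelMeasure P a))
    (n := fun x : Σ N, (Fin N → ℂ × ℂ × ℂ) => x.1) (fun x => a x.1) m hf'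
    (r := fun x => modelSpectrum Q x.2) (z := fun x k => (x.2 k).1) hr
    -- The sum of two bounds, one eventually valid for `α z + s g` and one for `z`, serves for both.
    (B := (‖α‖ * √p + ‖(s : ℂ)‖ * 1 + 1) + (√p + 1))
    (by
      filter_upwards [hr'.eventually_le_const (lt_add_one _)] with x hx
      have := rms_add_le (α • (fun k => (x.2 k).1)) ((s : ℂ) • fun k => (x.2 k).2.2)
      rw [rms_smul, rms_smul] at this
      have := Real.sqrt_nonneg p
      linarith)
    (by
      filter_upwards [hz.eventually_le_const (lt_add_one _)] with x hx
      have : 0 ≤ ‖α‖ * √p + ‖(s : ℂ)‖ * 1 := by positivity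
      linarith)
  have h3 := h2.add h1
  rw [zero_add] at h3
  exact h3.congr fun x => sub_add_cancel _ _

end Model

/-! ### Reduction to countably many test functions. -/

section CountableFamily

variable {E : Type*} [NormedAddCommGroup E]

lemma quadraticModulus_one_add_norm_sq : QuadraticModulus fun x : E => 1 + ‖x‖ ^ 2 := by
  intro ε hε
  refine ⟨1 + 1 / ε, by positivity, fun x y => ?_⟩
  have h1 := norm_sub_norm_le x y
  have h2 := norm_sub_norm_le y x
  rw [norm_sub_rev] at h2
  set d := ‖x - y‖ with hd
  have hd0 : 0 ≤ d := norm_nonneg _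
  -- Weighted AM–GM: the cross term of the expanded square is split between the two terms of the
  -- modulus.
  have key : 2 * ‖y‖ * d ≤ ε * ‖y‖ ^ 2 + 1 / ε * d ^ 2 := by
    have := sq_nonneg (ε * ‖y‖ - d)
    have h3 : 0 ≤ (ε * ‖y‖ - d) ^ 2 / ε := by positivity
    have h4 : (ε * ‖y‖ - d) ^ 2 / ε = ε * ‖y‖ ^ 2 - 2 * ‖y‖ * d + 1 / ε * d ^ 2 := by
      field_simp; ring
    linarith
  have hx := norm_nonneg x
  have hy := norm_nonneg y
  have hxy : |‖x‖ - ‖y‖| ≤ d := abs_le.2 ⟨by linarith, by linarith⟩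
  calc |1 + ‖x‖ ^ 2 - (1 + ‖y‖ ^ 2)| = |‖x‖ - ‖y‖| * (‖x‖ + ‖y‖) := by
        rw [← abs_of_nonneg (by positivity : 0 ≤ ‖x‖ + ‖y‖), ← abs_mul]
        congr 1; ring
    _ ≤ d * (2 * ‖y‖ + d) := mul_le_mul hxy (by linarith) (by positivity) hd0
    _ ≤ ε * (1 + ‖y‖ ^ 2) + (1 + 1 / ε) * d ^ 2 := by nlinarith

/-- Nearby points are handled by uniform continuity; at distance at least `d`, the oscillation `2B`
is at most `(2B/d²) ‖x - y‖²`. -/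
lemma QuadraticModulus.of_hasCompactSupport {f : E → ℝ} (hf : Continuous f)
    (hc : HasCompactSupport f) : QuadraticModulus f := by
  intro ε hε
  obtain ⟨B, hB⟩ := hf.bounded_above_of_compact_support hc
  have hB0 : 0 ≤ B := (norm_nonneg _).trans (hB 0)
  obtain ⟨d, hd, h⟩ := Metric.uniformContinuous_iff.1
    (hc.uniformContinuous_of_continuous hf) ε hε
  refine ⟨2 * B / d ^ 2, by positivity, fun x y => ?_⟩
  rcases lt_or_ge (dist x y) d with hxy | hxy
  · have := (h hxy).le
    rw [Real.dist_eq] at this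
    have h2 : 0 ≤ 2 * B / d ^ 2 * ‖x - y‖ ^ 2 := by positivity
    nlinarith [sq_nonneg ‖y‖]
  · rw [dist_eq_norm] at hxy
    have h1 : |f x - f y| ≤ 2 * B := by
      refine (abs_sub _ _).trans ?_
      have := hB x
      have := hB y
      simp only [Real.norm_eq_abs] at *
      linarith
    have h2 : 2 * B ≤ 2 * B / d ^ 2 * ‖x - y‖ ^ 2 := by
      rw [div_mul_eq_mul_div, le_div_iff₀ (by positivity)]
      gcongr
    have h3 : 0 ≤ ε * (1 + ‖y‖ ^ 2) := by positivity
    linarith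

/-- A continuous cutoff, equal to one on the ball of radius `R` and vanishing outside the ball of
radius `R + 1`. -/
def cutoff (R : ℕ) (x : E) : ℝ := max 0 (min 1 (R + 1 - ‖x‖))

lemma continuous_cutoff (R : ℕ) : Continuous (cutoff R : E → ℝ) := by
  unfold cutoff; fun_prop

lemma cutoff_nonneg (R : ℕ) (x : E) : 0 ≤ cutoff R x := le_max_left _ _

lemma cutoff_le_one (R : ℕ) (x : E) : cutoff R x ≤ 1 := max_le zero_le_one (min_le_left _ _)

lemma cutoff_eq_zero {R : ℕ} {x : E} (hx : (R : ℝ) + 1 ≤ ‖x‖) : cutoff R x = 0 :=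
  max_eq_left ((min_le_right _ _).trans (by linarith))

lemma cutoff_eq_one {R : ℕ} {x : E} (hx : ‖x‖ ≤ R) : cutoff R x = 1 := by
  rw [cutoff, min_eq_left (by linarith), max_eq_right zero_le_one]

lemma tendsto_integral_cutoff [MeasurableSpace E] [OpensMeasurableSpace E] {ν : Measure E} (hν : Integrable (fun x => 1 + ‖x‖ ^ 2) ν) :
    Tendsto (fun R : ℕ => ∫ x, (1 + ‖x‖ ^ 2) * cutoff R x ∂ν) atTop
      (𝓝 (∫ x, 1 + ‖x‖ ^ 2 ∂ν)) := by
  refine tendsto_integral_of_dominated_convergence (fun x => 1 + ‖x‖ ^ 2)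
    (fun R => ?_) hν (fun R => .of_forall fun x => ?_) (.of_forall fun x => ?_)
  · have := continuous_cutoff (E := E) R
    exact (by fun_prop : Continuous fun x : E => (1 + ‖x‖ ^ 2) * cutoff R x).aestronglyMeasurable
  · rw [Real.norm_eq_abs, abs_of_nonneg (mul_nonneg (by positivity) (cutoff_nonneg R x))]
    exact mul_le_of_le_one_right (by positivity) (cutoff_le_one R x)
  · refine tendsto_const_nhds.congr' ?_
    filter_upwards [eventually_ge_atTop ⌈‖x‖⌉₊] with R hR
    rw [cutoff_eq_one (Nat.ceil_le.1 hR), mul_one]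

lemma hasCompactSupport_mul_cutoff [ProperSpace E] (f : E → ℝ) (R : ℕ) :
    HasCompactSupport fun x => f x * cutoff R x := by
  refine HasCompactSupport.intro (isCompact_closedBall (0 : E) (R + 1)) fun x hx => ?_
  rw [mem_closedBall_zero_iff, not_le] at hx
  rw [cutoff_eq_zero hx.le, mul_zero]

variable (E) in
/-- A countable family of test functions which determines convergence with second moments. -/
def testFamily [ProperSpace E] : Set (E → ℝ) :=
  {fun x => 1 + ‖x‖ ^ 2} ∪ (Set.range fun (R : ℕ) x => (1 + ‖x‖ ^ 2) * cutoff R x) ∪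
    Set.range fun (i : ℕ × ℕ) x => TopologicalSpace.denseSeq C(E, ℝ) i.1 x * cutoff i.2 x

variable [ProperSpace E]

variable (E) in
lemma countable_testFamily : (testFamily E).Countable :=
  ((Set.countable_singleton _).union (Set.countable_range _)).union (Set.countable_range _)

lemma testFamily_spec {f : E → ℝ} (hf : f ∈ testFamily E) : Continuous f ∧ QuadraticModulus f := by
  have hq : Continuous fun x : E => 1 + ‖x‖ ^ 2 := by fun_prop
  rcases hf with (rfl | ⟨R, rfl⟩) | ⟨i, rfl⟩
  · exact ⟨hq, quadraticModulus_one_add_norm_sq⟩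
  · have hc := hq.mul (continuous_cutoff R)
    exact ⟨hc, .of_hasCompactSupport hc (hasCompactSupport_mul_cutoff _ R)⟩
  · have hc := (TopologicalSpace.denseSeq C(E, ℝ) i.1).continuous.mul (continuous_cutoff i.2)
    exact ⟨hc, .of_hasCompactSupport hc (hasCompactSupport_mul_cutoff _ i.2)⟩

/-- Density in the compact-open topology is uniform approximation on closed balls, which are compact
here. -/
lemma exists_denseSeq_near {f : E → ℝ} (hf : Continuous f) (R : ℝ) {η : ℝ} (hη : 0 < η) :
    ∃ n, ∀ x : E, ‖x‖ ≤ R → |f x - TopologicalSpace.denseSeq C(E, ℝ) n x| < η := by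
  have hd : (⟨f, hf⟩ : C(E, ℝ)) ∈ closure (Set.range (TopologicalSpace.denseSeq C(E, ℝ))) :=
    TopologicalSpace.denseRange_denseSeq _ _
  obtain ⟨u, hu, hlim⟩ := mem_closure_iff_seq_limit.1 hd
  have h := ContinuousMap.tendsto_iff_forall_isCompact_tendstoUniformlyOn.1 hlim _
    (isCompact_closedBall (0 : E) R)
  obtain ⟨N, hN⟩ := (Metric.tendstoUniformlyOn_iff.1 h η hη).exists
  obtain ⟨n, hn⟩ := hu N
  refine ⟨n, fun x hx => ?_⟩
  rw [hn, ← Real.dist_eq]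
  exact hN x (mem_closedBall_zero_iff.2 hx)

variable [MeasurableSpace E] [BorelSpace E]

/-- Convergence of monotone functionals on the countable family implies convergence on all
continuous functions of at most quadratic growth. -/
lemma tendsto_of_testFamily {ν : Measure E} (hν : Integrable (fun x => 1 + ‖x‖ ^ 2) ν) {δ : ℝ}
    (hδ : 0 ≤ δ) {L : ℕ → (E → ℝ) →ₗ[ℝ] ℝ} (hmono : ∀ N f g, (∀ x, f x ≤ g x) → L N f ≤ L N g)
    (hL : ∀ f ∈ testFamily E, Tendsto (fun N => L N f) atTop (𝓝 (δ * ∫ x, f x ∂ν)))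
    {f : E → ℝ} (hf : Continuous f) {C : ℝ} (hC : 0 ≤ C) (hfC : ∀ x, |f x| ≤ C * (1 + ‖x‖ ^ 2)) :
    Tendsto (fun N => L N f) atTop (𝓝 (δ * ∫ x, f x ∂ν)) := by
  set q : E → ℝ := fun x => 1 + ‖x‖ ^ 2 with hq
  have hq1 : ∀ x, 1 ≤ q x := fun x => by simp only [hq]; nlinarith [sq_nonneg ‖x‖]
  refine Metric.tendsto_nhds.2 fun ε hε => ?_
  set I := ∫ x, q x ∂ν with hI
  have hI0 : 0 ≤ I := integral_nonneg fun x => zero_le_one.trans (hq1 x)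
  -- The final error is less than `2δη(C + I) + 2η`; the last `+ 1` leaves slack.
  set η := ε / (2 * (δ * (C + I) + 1) + 1) with hη
  have hD : 0 < 2 * (δ * (C + I) + 1) + 1 := by positivity
  have hη0 : 0 < η := by positivity
  obtain ⟨R, hR⟩ := ((tendsto_integral_cutoff hν).eventually_const_lt
    (sub_lt_self I hη0)).exists
  obtain ⟨n, hn⟩ := exists_denseSeq_near hf (R + 1) hη0
  set φ : E → ℝ := fun x => TopologicalSpace.denseSeq C(E, ℝ) n x with hφ
  set g : E → ℝ := fun x => φ x * cutoff R x with hg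
  set qc : E → ℝ := fun x => q x * cutoff R x with hqc
  have hgF : g ∈ testFamily E := Or.inr ⟨(n, R), rfl⟩
  have hqF : q ∈ testFamily E := Or.inl (Or.inl rfl)
  have hqcF : qc ∈ testFamily E := Or.inl (Or.inr ⟨R, rfl⟩)
  -- `G = η q + C (q - qc)` dominates `|f - g|`: the first term pays for approximating `f` by `φ` on
  -- the ball, the second for the cut-off tail. As a combination of members of the family it has a
  -- known limit, so no mass escapes to infinity.
  set G : E → ℝ := (C + η) • q - C • qc with hG
  have hle : ∀ x, |f x - g x| ≤ G x := fun x => by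
    have h0 := cutoff_nonneg R x
    have h1 := cutoff_le_one R x
    have e : f x - g x = f x * (1 - cutoff R x) + (f x - φ x) * cutoff R x := by
      simp only [hg]; ring
    have e2 : |(f x - φ x) * cutoff R x| ≤ η * q x := by
      rcases le_or_gt ((R : ℝ) + 1) ‖x‖ with h | h
      · rw [cutoff_eq_zero h, mul_zero, abs_zero]
        exact mul_nonneg hη0.le (zero_le_one.trans (hq1 x))
      · rw [abs_mul, abs_of_nonneg h0]
        calc |f x - φ x| * cutoff R x ≤ η * 1 := mul_le_mul (hn x h.le).le h1 h0 hη0.le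
          _ ≤ η * q x := mul_le_mul_of_nonneg_left (hq1 x) hη0.le
    have e3 : |f x * (1 - cutoff R x)| ≤ C * q x * (1 - cutoff R x) := by
      rw [abs_mul, abs_of_nonneg (sub_nonneg.2 h1)]
      exact mul_le_mul_of_nonneg_right (hfC x) (sub_nonneg.2 h1)
    rw [e]
    refine (abs_add_le _ _).trans ((add_le_add e3 e2).trans (le_of_eq ?_))
    simp only [hG, hqc, Pi.sub_apply, Pi.smul_apply, smul_eq_mul]
    ring
  have hqci : Integrable qc ν := by
    refine hν.mono (testFamily_spec hqcF).1.aestronglyMeasurable (.of_forall fun x => ?_)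
    rw [Real.norm_eq_abs, Real.norm_eq_abs, abs_mul, abs_of_nonneg (cutoff_nonneg R x)]
    exact mul_le_of_le_one_right (abs_nonneg _) (cutoff_le_one R x)
  have hGi : Integrable G ν := (hν.smul _).sub (hqci.smul _)
  have hfi : Integrable f ν := by
    refine (hν.const_mul C).mono hf.aestronglyMeasurable (.of_forall fun x => ?_)
    exact (hfC x).trans (le_abs_self _)
  have hgi : Integrable g ν := by
    refine (hfi.norm.add hGi).mono (testFamily_spec hgF).1.aestronglyMeasurable
      (.of_forall fun x => ?_)
    refine le_trans ?_ (le_abs_self _)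
    simp only [Pi.add_apply, Real.norm_eq_abs]
    have := abs_sub_abs_le_abs_sub (g x) (f x)
    rw [abs_sub_comm] at this
    linarith [hle x]
  have hGint : ∫ x, G x ∂ν = (C + η) * I - C * ∫ x, qc x ∂ν := by
    have h1 : Integrable (fun x => (C + η) * q x) ν := hν.const_mul _
    have h2 : Integrable (fun x => C * qc x) ν := hqci.const_mul _
    calc ∫ x, G x ∂ν = ∫ x, ((C + η) * q x - C * qc x) ∂ν := rfl
      _ = _ := by rw [integral_sub h1 h2, integral_const_mul, integral_const_mul]
  have hGb : ∫ x, G x ∂ν ≤ η * (C + I) := by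
    rw [hGint]
    have : C * (I - ∫ x, qc x ∂ν) ≤ C * η := mul_le_mul_of_nonneg_left (by linarith) hC
    linarith
  have hLG : Tendsto (fun N => L N G) atTop (𝓝 (δ * ∫ x, G x ∂ν)) := by
    have h := ((hL q hqF).const_mul (C + η)).sub ((hL qc hqcF).const_mul C)
    have e : (C + η) * (δ * ∫ x, q x ∂ν) - C * (δ * ∫ x, qc x ∂ν) = δ * ∫ x, G x ∂ν := by
      rw [hGint]; ring
    rw [e] at h
    refine h.congr fun N => ?_
    rw [hG, map_sub, map_smul, map_smul, smul_eq_mul, smul_eq_mul]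
  have hint : |∫ x, g x ∂ν - ∫ x, f x ∂ν| ≤ ∫ x, G x ∂ν := by
    rw [← integral_sub hgi hfi]
    refine (abs_integral_le_integral_abs).trans (integral_mono (hgi.sub hfi).abs hGi fun x => ?_)
    beta_reduce
    rw [abs_sub_comm]; exact hle x
  filter_upwards [hLG.eventually_le_const (lt_add_of_pos_right _ hη0),
    Metric.tendsto_nhds.1 (hL g hgF) η hη0] with N h1 h2
  rw [Real.dist_eq] at h2 ⊢
  have h3 : |L N f - L N g| ≤ L N G := by
    rw [← map_sub, abs_le]
    refine ⟨?_, hmono N _ _ fun x => (le_abs_self _).trans (hle x)⟩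
    rw [← map_neg]
    refine hmono N _ _ fun x => ?_
    have := (neg_abs_le (f x - g x))
    have := hle x
    simp only [Pi.neg_apply, Pi.sub_apply]
    linarith
  have h4 : |δ * ∫ x, g x ∂ν - δ * ∫ x, f x ∂ν| ≤ δ * ∫ x, G x ∂ν := by
    rw [← mul_sub, abs_mul, abs_of_nonneg hδ]
    exact mul_le_mul_of_nonneg_left hint hδ
  have h5 : δ * ∫ x, G x ∂ν ≤ δ * (η * (C + I)) := mul_le_mul_of_nonneg_left hGb hδ
  have h6 : |L N f - δ * ∫ x, f x ∂ν| ≤ |L N f - L N g| + |L N g - δ * ∫ x, g x ∂ν| +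
      |δ * ∫ x, g x ∂ν - δ * ∫ x, f x ∂ν| :=
    (abs_sub_le _ (δ * ∫ x, g x ∂ν) _).trans (add_le_add_left (abs_sub_le _ (L N g) _) _)
  have h7 : η * (2 * (δ * (C + I) + 1) + 1) = ε := div_mul_cancel₀ _ hD.ne'
  linarith

end CountableFamily

/-! ### From the model back to the random transform. -/

section Transfer

variable {M : ℕ} {P : Fin M → ℝ} {a : (N : ℕ) → Fin N → Fin M} {δ : Fin M → ℝ}

lemma measurePreserving_model_symbols (P : Fin M → ℝ) {N : ℕ} (b : Fin N → Fin M) :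
    MeasurePreserving
      ((MeasurableEquiv.arrowProdEquivProdArrow ℂ (ℂ × ℂ) (Fin N)).trans
        ((MeasurableEquiv.refl (Fin N → ℂ)).prodCongr
          (MeasurableEquiv.arrowProdEquivProdArrow ℂ ℂ (Fin N))))
      (Measure.pi fun k => modelLaw (P (b k)))
      ((Measure.pi fun k => complexGaussian (P (b k))).prod
        ((gaussianVec N).prod (gaussianVec N))) := by
  have h1 := measurePreserving_arrowProdEquivProdArrow ℂ (ℂ × ℂ) (Fin N)
    (fun k => complexGaussian (P (b k)))
    (fun _ => (complexGaussian 1).prod (complexGaussian 1))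
  have h2 := measurePreserving_arrowProdEquivProdArrow ℂ ℂ (Fin N)
    (fun _ => complexGaussian 1) (fun _ => complexGaussian 1)
  exact ((MeasurePreserving.id _).prod h2).comp h1

/-- The average over a sub-band, as a linear functional of the test function. -/
def bandAverage {N : ℕ} {E : Type*} (b : Fin N → Fin M) (m : Fin M) (y : Fin N → E) :
    (E → ℝ) →ₗ[ℝ] ℝ where
  toFun f := (1 / (N : ℝ)) * ∑ k, if b k = m then f (y k) else 0
  map_add' f g := by
    rw [← mul_add, ← Finset.sum_add_distrib]
    congr 1
    exact Finset.sum_congr rfl fun k _ => by split_ifs <;> simp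
  map_smul' c f := by
    rw [RingHom.id_apply, smul_eq_mul, mul_left_comm, Finset.mul_sum _ _ c]
    congr 1
    exact Finset.sum_congr rfl fun k _ => by split_ifs <;> simp

lemma bandAverage_apply {N : ℕ} {E : Type*} (b : Fin N → Fin M) (m : Fin M) (y : Fin N → E)
    (f : E → ℝ) :
    bandAverage b m y f = (1 / (N : ℝ)) * ∑ k, if b k = m then f (y k) else 0 := rfl

lemma bandAverage_mono {N : ℕ} {E : Type*} (b : Fin N → Fin M) (m : Fin M) (y : Fin N → E)
    {f g : E → ℝ} (h : ∀ x, f x ≤ g x) : bandAverage b m y f ≤ bandAverage b m y g := by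
  refine mul_le_mul_of_nonneg_left (Finset.sum_le_sum fun k _ => ?_) (by positivity)
  split_ifs
  · exact h _
  · exact le_rfl

lemma sum_bandAverage {N : ℕ} {E : Type*} (b : Fin N → Fin M) (y : Fin N → E)
    (f : Fin M → E → ℝ) :
    ∑ m, bandAverage b m y (f m) = (1 / (N : ℝ)) * ∑ k, f (b k) (y k) := by
  simp_rw [bandAverage_apply, ← Finset.mul_sum]
  rw [Finset.sum_comm]
  simp

/-- Convergence over a sub-band for a single test function, along the laws of the pairs formed by
the random transform and the random symbols. -/
lemma tendsto_bandAverage_spectrumVec (hP : ∀ m, 0 ≤ P m)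
    (hδ : ∀ m, Tendsto (fun N => bandFraction (a N) m) atTop (𝓝 (δ m)))
    (hpos : 0 < avgPower δ P) {Q : ℂ → ℂ} {K : NNReal} (hQ : LipschitzWith K Q)
    (η : ∀ N, Measure (Matrix.unitaryGroup (Fin N) ℂ)) [∀ N, IsProbabilityMeasure (η N)]
    [∀ N, (η N).IsMulLeftInvariant] (m : Fin M)
    {f : ℂ × ℂ → ℝ} (hf : Continuous f) (hf' : QuadraticModulus f) :
    Tendsto (fun x : Σ N, Matrix.unitaryGroup (Fin N) ℂ × (Fin N → ℂ) =>
      bandAverage (a x.1) m (fun k => (spectrumVec Q x.2.1 x.2.2 k, x.2.2 k)) f)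
      (summableFilter fun N => (η N).prod (Measure.pi fun k => complexGaussian (P (a N k))))
      (𝓝 (δ m * ∫ y, f y ∂bandLaw (gain Q (avgPower δ P))
        (distortion Q (avgPower δ P) * avgPower δ P) (P m))) := by
  set c := δ m * ∫ y, f y ∂bandLaw (gain Q (avgPower δ P))
    (distortion Q (avgPower δ P) * avgPower δ P) (P m) with hc
  have h1 := modelSpectrum_average_tendsto hP hδ hpos hQ m hf hf'
  have h2 := (modelSpectrum_tendsto hP hδ hpos hQ).2.2.2
  refine Metric.tendsto_nhds.2 fun ε hε => ?_
  have h3 := eventually_summableFilter.1 (h2.and (Metric.tendsto_nhds.1 h1 ε hε))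
  -- For each `N`, failure for the true spectrum is at most as likely as failure of the model or its
  -- degeneracy, whose probabilities are summable.
  refine eventually_summableFilter.2
    (ne_top_of_le_ne_top h3 (ENNReal.tsum_le_tsum fun N => ?_))
  set S : Set ((Fin N → ℂ) × (Fin N → ℂ)) :=
    {p | ¬ dist (bandAverage (a N) m (fun k => (p.1 k, p.2 k)) f) c < ε} with hS
  have hSm : MeasurableSet S := by
    have hcont : Continuous fun p : (Fin N → ℂ) × (Fin N → ℂ) =>
        bandAverage (a N) m (fun k => (p.1 k, p.2 k)) f := by
      simp only [bandAverage_apply]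
      refine continuous_const.mul (continuous_finsetSum _ fun k _ => ?_)
      split_ifs
      · fun_prop
      · exact continuous_const
    exact (measurableSet_lt (hcont.dist continuous_const).measurable measurable_const).compl
  refine (measure_prod_spectrumVec_le hQ.continuous.measurable
    (Measure.pi fun k => complexGaussian (P (a N k))) hSm).trans ?_
  rw [← (measurePreserving_model_symbols P (a N)).measure_preimage_equiv]
  refine measure_mono fun ω hω => ?_
  rintro ⟨⟨hh, hg⟩, hd⟩
  rcases hω with h | h | h
  · exact hh h
  · exact hg h
  · exact h hd

/-- Almost sure convergence over a sub-band for a single test function. -/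
lemma ae_tendsto_bandAverage {Ω : Type*} [MeasurableSpace Ω] {μ : Measure Ω}
    [IsProbabilityMeasure μ] (hP : ∀ m, 0 ≤ P m)
    (hδ : ∀ m, Tendsto (fun N => bandFraction (a N) m) atTop (𝓝 (δ m)))
    (hpos : 0 < avgPower δ P) {Q : ℂ → ℂ} {K : NNReal} (hQ : LipschitzWith K Q)
    {V : (N : ℕ) → Ω → Matrix.unitaryGroup (Fin N) ℂ} (hV : ∀ N, IsHaarUnitary (V N) μ)
    {z : (N : ℕ) → Fin N → Ω → ℂ}
    (hz : ∀ N k, HasLaw (z N k) (complexGaussian (P (a N k))) μ)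
    (hzind : ∀ N, iIndepFun (z N) μ)
    (hVz : ∀ N, IndepFun (V N) (fun ω k => z N k ω) μ) (m : Fin M)
    {f : ℂ × ℂ → ℝ} (hf : Continuous f) (hf' : QuadraticModulus f) :
    ∀ᵐ ω ∂μ, Tendsto (fun N => bandAverage (a N) m
      (fun k => (spectrumVec Q (V N ω) (fun k => z N k ω) k, z N k ω)) f) atTop
      (𝓝 (δ m * ∫ y, f y ∂bandLaw (gain Q (avgPower δ P))
        (distortion Q (avgPower δ P) * avgPower δ P) (P m))) := by
  have hzm : ∀ N, AEMeasurable (fun ω k => z N k ω) μ := fun N =>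
    aemeasurable_pi_lambda _ fun k => (hz N k).aemeasurable
  have hprob : ∀ N, IsProbabilityMeasure (μ.map (V N)) := fun N =>
    Measure.isProbabilityMeasure_map (hV N).1
  have hinv : ∀ N, (μ.map (V N)).IsMulLeftInvariant := fun N =>
    (hV N).2.toIsMulLeftInvariant
  -- Independence enters only here, for each `N` separately.
  have hlaw : ∀ N, μ.map (fun ω => (V N ω, fun k => z N k ω)) =
      (μ.map (V N)).prod (Measure.pi fun k => complexGaussian (P (a N k))) := fun N => by
    rw [(indepFun_iff_map_prod_eq_prod_map_map (hV N).1 (hzm N)).1 (hVz N),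
      (iIndepFun_iff_map_fun_eq_pi_map fun k => (hz N k).aemeasurable).1 (hzind N)]
    simp only [fun k => (hz N k).map_eq]
  have hlim := tendsto_bandAverage_spectrumVec hP hδ hpos hQ (fun N => μ.map (V N)) m hf hf'
  have h := ae_tendsto_of_summableFilter (T := fun N ω => (V N ω, fun k => z N k ω))
    (fun N => (hV N).1.prodMk (hzm N)) hlaw hlim
  filter_upwards [h] with ω hω
  exact hω

end Transfer

/-! ### Second moments of the limit law in a sub-band. -/

section BandLaw

lemma memLp_two_complexGaussian (v : ℝ) : MemLp (fun u : ℂ => u) 2 (complexGaussian v) := by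
  exact_mod_cast memLp_id_complexGaussian v 2

instance isProbabilityMeasure_bandLaw (α : ℂ) (v p : ℝ) : IsProbabilityMeasure (bandLaw α v p) :=
  Measure.isProbabilityMeasure_map (by fun_prop)

lemma measurePreserving_bandLaw_prod (α : ℂ) (v p : ℝ) :
    MeasurePreserving (fun q : ℂ × ℂ => (α * q.1 + q.2, q.1))
      ((complexGaussian p).prod (complexGaussian v)) (bandLaw α v p) := ⟨by fun_prop, rfl⟩

lemma integrable_norm_sq_bandLaw (α : ℂ) (v p : ℝ) :
    Integrable (fun y => 1 + ‖y‖ ^ 2) (bandLaw α v p) := by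
  have h1 : MemLp (fun q : ℂ × ℂ => q.1) 2 ((complexGaussian p).prod (complexGaussian v)) :=
    (memLp_two_complexGaussian p).comp_measurePreserving measurePreserving_fst
  have h2 : MemLp (fun q : ℂ × ℂ => q.2) 2 ((complexGaussian p).prod (complexGaussian v)) :=
    (memLp_two_complexGaussian v).comp_measurePreserving measurePreserving_snd
  have h3 : MemLp (fun q : ℂ × ℂ => (α * q.1 + q.2, q.1)) 2
      ((complexGaussian p).prod (complexGaussian v)) := by
    refine (((h1.const_mul α).add h2).norm.add h1.norm).mono (by fun_prop) (.of_forall fun q => ?_)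
    refine le_trans ?_ (le_abs_self _)
    rw [Prod.norm_def]
    exact max_le (le_add_of_nonneg_right (norm_nonneg _)) (le_add_of_nonneg_left (norm_nonneg _))
  have h4 : MemLp (fun y : ℂ × ℂ => y) 2 (bandLaw α v p) :=
    (memLp_map_measure_iff (by fun_prop) (by fun_prop)).2 h3
  exact (integrable_const _).add (h4.integrable_norm_pow two_ne_zero)

lemma integral_norm_fst_sq_bandLaw (α : ℂ) {v p : ℝ} (hv : 0 ≤ v) (hp : 0 ≤ p) :
    ∫ y, ‖y.1‖ ^ 2 ∂bandLaw α v p = ‖α‖ ^ 2 * p + v := by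
  rw [← integral_comp_of_measurePreserving (measurePreserving_bandLaw_prod α v p)
    (F := fun y : ℂ × ℂ => ‖y.1‖ ^ 2) (by fun_prop)]
  have hz := memLp_two_complexGaussian p
  have hw := memLp_two_complexGaussian v
  have i1 : Integrable (fun q : ℂ × ℂ => ‖α‖ ^ 2 * ‖q.1‖ ^ 2)
      ((complexGaussian p).prod (complexGaussian v)) :=
    ((hz.integrable_norm_pow two_ne_zero).comp_fst _).const_mul _
  have i2 : Integrable (fun q : ℂ × ℂ => ‖q.2‖ ^ 2)
      ((complexGaussian p).prod (complexGaussian v)) :=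
    (hw.integrable_norm_pow two_ne_zero).comp_snd _
  have i3 : Integrable (fun q : ℂ × ℂ => conj (α * q.1) * q.2)
      ((complexGaussian p).prod (complexGaussian v)) := by
    have hz1 : Integrable (fun u : ℂ => conj (α * u)) (complexGaussian p) :=
      (Complex.conjCLE.integrable_comp_iff).2 ((hz.integrable one_le_two).const_mul α)
    exact hz1.mul_prod (hw.integrable one_le_two)
  have e : ∀ q : ℂ × ℂ, ‖α * q.1 + q.2‖ ^ 2 =
      ‖α‖ ^ 2 * ‖q.1‖ ^ 2 + ‖q.2‖ ^ 2 + 2 * (conj (α * q.1) * q.2).re := fun q => by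
    rw [← mul_pow, ← norm_mul, Complex.sq_norm, Complex.sq_norm, Complex.sq_norm,
      Complex.normSq_apply, Complex.normSq_apply, Complex.normSq_apply]
    simp only [Complex.add_re, Complex.add_im, Complex.mul_re, Complex.conj_re, Complex.conj_im]
    ring
  -- The cross term vanishes because the noise is centred and independent of the symbol.
  have h3 : ∫ q : ℂ × ℂ, (conj (α * q.1) * q.2).re
      ∂((complexGaussian p).prod (complexGaussian v)) = 0 := by
    have h := integral_re i3
    simp only [RCLike.re_eq_complex_re] at h
    rw [h, integral_prod_mul (fun u : ℂ => conj (α * u)) (fun u : ℂ => u),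
      integral_id_complexGaussian, mul_zero, Complex.zero_re]
  simp_rw [e]
  have i3' : Integrable (fun q : ℂ × ℂ => 2 * (conj (α * q.1) * q.2).re)
      ((complexGaussian p).prod (complexGaussian v)) := (i3.re).const_mul 2
  have h1 := integral_fun_fst (μ := complexGaussian p) (ν := complexGaussian v)
    (fun u : ℂ => ‖u‖ ^ 2)
  have h2 := integral_fun_snd (μ := complexGaussian p) (ν := complexGaussian v)
    (fun u : ℂ => ‖u‖ ^ 2)
  rw [integral_add, integral_add, integral_const_mul, integral_const_mul, h3,
    h1, h2, integral_norm_sq_complexGaussian hp, integral_norm_sq_complexGaussian hv]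
  · simp
  · exact i1
  · exact i2
  · exact i1.add i2
  · exact i3'

end BandLaw

/-! ### Pseudo-Lipschitz functions are continuous of quadratic growth, which is all the limit
argument uses. -/

section Pseudolipschitz

variable {E : Type*} [NormedAddCommGroup E] {f : E → ℝ}

lemma PseudoLipschitz.continuous (hf : PseudoLipschitz 2 f) : Continuous f := by
  obtain ⟨C, -, h⟩ := hf
  refine continuous_iff_continuousAt.2 fun x => tendsto_iff_dist_tendsto_zero.2 ?_
  have hb : Tendsto (fun y => C * ‖y - x‖ * (1 + ‖y‖ ^ (2 - 1) + ‖x‖ ^ (2 - 1))) (𝓝 x) (𝓝 0) := by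
    have : Continuous fun y => C * ‖y - x‖ * (1 + ‖y‖ ^ (2 - 1) + ‖x‖ ^ (2 - 1)) := by fun_prop
    simpa using this.tendsto x
  exact squeeze_zero (fun _ => dist_nonneg) (fun y => by rw [Real.dist_eq]; exact h y x) hb

lemma PseudoLipschitz.exists_abs_le (hf : PseudoLipschitz 2 f) :
    ∃ C, 0 ≤ C ∧ ∀ x, |f x| ≤ C * (1 + ‖x‖ ^ 2) := by
  obtain ⟨C, hC, h⟩ := hf
  refine ⟨|f 0| + 2 * C, by positivity, fun x => ?_⟩
  have h1 := h x 0
  simp only [sub_zero, norm_zero, Nat.reduceSub, pow_one, add_zero] at h1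
  have h2 : |f x| ≤ |f x - f 0| + |f 0| := by
    have := abs_add_le (f x - f 0) (f 0)
    rwa [sub_add_cancel] at this
  have h3 : C * ‖x‖ * (1 + ‖x‖) ≤ C * (2 * (1 + ‖x‖ ^ 2)) := by
    rw [mul_assoc]
    refine mul_le_mul_of_nonneg_left ?_ hC.le
    nlinarith [sq_nonneg (‖x‖ - 1), norm_nonneg x]
  have h4 : 0 ≤ |f 0| * ‖x‖ ^ 2 := by positivity
  linarith

end Pseudolipschitz

/-! ### Assembling the sub-bands. -/

section Conclusion

variable {M : ℕ} {P : Fin M → ℝ} {a : (N : ℕ) → Fin N → Fin M} {δ : Fin M → ℝ}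

/-- Almost sure convergence over each sub-band, for all test functions of quadratic growth
simultaneously. -/
lemma ae_forall_tendsto_bandAverage {Ω : Type*} [MeasurableSpace Ω] {μ : Measure Ω}
    [IsProbabilityMeasure μ] (hP : ∀ m, 0 ≤ P m)
    (hδ : ∀ m, Tendsto (fun N => bandFraction (a N) m) atTop (𝓝 (δ m)))
    (hpos : 0 < avgPower δ P) {Q : ℂ → ℂ} {K : NNReal} (hQ : LipschitzWith K Q)
    {V : (N : ℕ) → Ω → Matrix.unitaryGroup (Fin N) ℂ} (hV : ∀ N, IsHaarUnitary (V N) μ)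
    {z : (N : ℕ) → Fin N → Ω → ℂ}
    (hz : ∀ N k, HasLaw (z N k) (complexGaussian (P (a N k))) μ)
    (hzind : ∀ N, iIndepFun (z N) μ)
    (hVz : ∀ N, IndepFun (V N) (fun ω k => z N k ω) μ) :
    ∀ᵐ ω ∂μ, ∀ (m : Fin M) (f : ℂ × ℂ → ℝ), Continuous f →
      (∃ C, 0 ≤ C ∧ ∀ x, |f x| ≤ C * (1 + ‖x‖ ^ 2)) →
      Tendsto (fun N => bandAverage (a N) m
        (fun k => (spectrumVec Q (V N ω) (fun k => z N k ω) k, z N k ω)) f) atTop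
        (𝓝 (δ m * ∫ y, f y ∂bandLaw (gain Q (avgPower δ P))
          (distortion Q (avgPower δ P) * avgPower δ P) (P m))) := by
  have h : ∀ᵐ ω ∂μ, ∀ m : Fin M, ∀ f ∈ testFamily (ℂ × ℂ), Tendsto (fun N => bandAverage (a N) m
        (fun k => (spectrumVec Q (V N ω) (fun k => z N k ω) k, z N k ω)) f) atTop
        (𝓝 (δ m * ∫ y, f y ∂bandLaw (gain Q (avgPower δ P))
          (distortion Q (avgPower δ P) * avgPower δ P) (P m))) :=
    ae_all_iff.2 fun m => (ae_ball_iff (countable_testFamily _)).2 fun f hf =>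
      ae_tendsto_bandAverage hP hδ hpos hQ hV hz hzind hVz m (testFamily_spec hf).1
        (testFamily_spec hf).2
  filter_upwards [h] with ω hω m f hf hfC
  obtain ⟨C, hC, hle⟩ := hfC
  exact tendsto_of_testFamily (integrable_norm_sq_bandLaw _ _ _) (limit_nonneg hδ m)
    (fun N f g hfg => bandAverage_mono _ _ _ hfg) (hω m) hf hC hle

lemma integrable_bandLaw_of_le {f : ℂ × ℂ → ℝ} (hf : Continuous f) {C : ℝ}
    (hC : ∀ x, |f x| ≤ C * (1 + ‖x‖ ^ 2)) (α : ℂ) (v p : ℝ) : Integrable f (bandLaw α v p) :=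
  ((integrable_norm_sq_bandLaw α v p).const_mul C).mono hf.aestronglyMeasurable
    (.of_forall fun x => (hC x).trans (le_abs_self _))

lemma agnLaw_eq (δ P : Fin M → ℝ) (α : ℂ) (v : ℝ) :
    agnLaw δ P α v = ∑ m, ENNReal.ofReal (δ m) •
      (bandLaw α v (P m)).map fun x => (x.1, x.2, ((m : ℕ) : ℝ)) := by
  refine Finset.sum_congr rfl fun m _ => ?_
  rw [bandLaw, Measure.map_map (by fun_prop) (by fun_prop)]
  rfl

lemma measurable_label (m : Fin M) :
    Measurable fun x : ℂ × ℂ => (x.1, x.2, ((m : ℕ) : ℝ)) := by fun_prop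

lemma integrable_agnLaw {f : ℂ × ℂ × ℝ → ℝ} (hf : Continuous f) {α : ℂ} {v : ℝ}
    (h : ∀ m : Fin M, Integrable (fun x : ℂ × ℂ => f (x.1, x.2, ((m : ℕ) : ℝ)))
      (bandLaw α v (P m))) : Integrable f (agnLaw δ P α v) := by
  rw [agnLaw_eq]
  refine integrable_finsetSum_measure.2 fun m _ => ?_
  refine Integrable.smul_measure ?_ ENNReal.ofReal_ne_top
  exact (integrable_map_measure hf.aestronglyMeasurable (measurable_label m).aemeasurable).2 (h m)

lemma integral_agnLaw (hδ : ∀ m, 0 ≤ δ m) {f : ℂ × ℂ × ℝ → ℝ} (hf : Continuous f) {α : ℂ} {v : ℝ}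
    (h : ∀ m : Fin M, Integrable (fun x : ℂ × ℂ => f (x.1, x.2, ((m : ℕ) : ℝ)))
      (bandLaw α v (P m))) :
    ∫ e, f e ∂agnLaw δ P α v =
      ∑ m : Fin M, δ m * ∫ x : ℂ × ℂ, f (x.1, x.2, ((m : ℕ) : ℝ)) ∂bandLaw α v (P m) := by
  rw [agnLaw_eq, integral_finsetSum_measure]
  · refine Finset.sum_congr rfl fun m _ => ?_
    rw [integral_smul_measure, integral_map (measurable_label m).aemeasurable
      hf.aestronglyMeasurable, ENNReal.toReal_ofReal (hδ m), smul_eq_mul]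
  · intro m _
    refine Integrable.smul_measure ?_ ENNReal.ofReal_ne_top
    exact (integrable_map_measure hf.aestronglyMeasurable (measurable_label m).aemeasurable).2 (h m)

lemma sum_norm_sq_transmitted {N : ℕ} (Q : ℂ → ℂ) (A : Matrix.unitaryGroup (Fin N) ℂ)
    (z : Fin N → ℂ) :
    ∑ n, ‖transmitted Q A z n‖ ^ 2 = ∑ k, ‖spectrumVec Q A z k‖ ^ 2 := by
  rw [← nrm_sq, ← nrm_sq, spectrumVec, nrm_mulVec]

end Conclusion

end TransformQuantization

end

theorem theorem1 {Ω : Type*} [MeasurableSpace Ω] (μ : Measure Ω) [IsProbabilityMeasure μ]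
    -- sub-bands, their powers, and the deterministic sub-band selection vectors
    (M : ℕ) (P : Fin M → ℝ) (hP : ∀ m, 0 ≤ P m)
    (a : (N : ℕ) → Fin N → Fin M) (δ : Fin M → ℝ)
    (hδ : ∀ m, Tendsto (fun N => bandFraction (a N) m) atTop (𝓝 (δ m)))
    (hpos : 0 < avgPower δ P)
    -- the scalar DAC function
    (Q : ℂ → ℂ) (hQ : ∃ K, LipschitzWith K Q)
    -- the random transforms
    (V : (N : ℕ) → Ω → Matrix.unitaryGroup (Fin N) ℂ) (hV : ∀ N, IsHaarUnitary (V N) μ)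
    -- the random symbols
    (z : (N : ℕ) → Fin N → Ω → ℂ)
    (hz : ∀ N k, HasLaw (z N k) (complexGaussian (P (a N k))) μ)
    (hzind : ∀ N, iIndepFun (z N) μ)
    (hVz : ∀ N, IndepFun (V N) (fun ω k => z N k ω) μ) :
    ∀ᵐ ω ∂μ,
      -- the energy in each sub-band
      (∀ m, Tendsto
        (fun N => bandEnergy (a N) m (spectrumVec Q (V N ω) (fun k => z N k ω))) atTop
        (𝓝 (δ m * (‖gain Q (avgPower δ P)‖ ^ 2 * P m
          + distortion Q (avgPower δ P) * avgPower δ P)))) ∧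
      -- the total energy
      Tendsto
        (fun N : ℕ => (1 / (N : ℝ)) * ∑ n, ‖transmitted Q (V N ω) (fun k => z N k ω) n‖ ^ 2) atTop
        (𝓝 ((‖gain Q (avgPower δ P)‖ ^ 2 + distortion Q (avgPower δ P)) * avgPower δ P)) ∧
      -- the additive Gaussian noise model
      ConvergesEmpirically 2
        (fun N k => (spectrumVec Q (V N ω) (fun k => z N k ω) k, z N k ω, (((a N k : Fin M) : ℕ) : ℝ)))
        (agnLaw δ P (gain Q (avgPower δ P)) (distortion Q (avgPower δ P) * avgPower δ P)) := by

  obtain ⟨K, hQ⟩ := hQ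
  have hδ0 := limit_nonneg hδ
  have hsum := sum_limit_eq_one hδ
  set α := gain Q (avgPower δ P) with hα
  set v := distortion Q (avgPower δ P) * avgPower δ P with hv
  have hv0 : 0 ≤ v := distortion_mul_nonneg Q hpos
  filter_upwards [ae_forall_tendsto_bandAverage hP hδ hpos hQ hV hz hzind hVz] with ω hω
  have hband : ∀ m, Tendsto
      (fun N => bandEnergy (a N) m (spectrumVec Q (V N ω) (fun k => z N k ω))) atTop
      (𝓝 (δ m * (‖α‖ ^ 2 * P m + v))) := fun m => by
    have h := hω m (fun y => ‖y.1‖ ^ 2) (by fun_prop) ⟨1, zero_le_one, fun x => by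
      rw [abs_of_nonneg (by positivity), one_mul]
      have := pow_le_pow_left₀ (norm_nonneg _) (norm_fst_le x) 2
      linarith⟩
    rw [integral_norm_fst_sq_bandLaw _ hv0 (hP m)] at h
    exact h
  refine ⟨hband, ?_, ?_⟩
  -- The total energy is the sum over sub-bands, since `V` preserves norms and `∑ δₘ = 1`.
  · have h := tendsto_finsetSum Finset.univ fun m _ => hband m
    have e : ∑ m, δ m * (‖α‖ ^ 2 * P m + v) =
        (‖α‖ ^ 2 + distortion Q (avgPower δ P)) * avgPower δ P := by
      have e' : ∀ m, δ m * (‖α‖ ^ 2 * P m + v) = ‖α‖ ^ 2 * (δ m * P m) + δ m * v := fun m => by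
        ring
      rw [Finset.sum_congr rfl fun m _ => e' m, Finset.sum_add_distrib, ← Finset.mul_sum,
        ← Finset.sum_mul, hsum, one_mul, add_mul, hv, avgPower]
    rw [e] at h
    refine h.congr fun N => ?_
    rw [sum_norm_sq_transmitted]
    exact sum_bandAverage (a N) (spectrumVec Q (V N ω) fun k => z N k ω) fun _ r => ‖r‖ ^ 2
  · intro f hf
    have hfc := hf.continuous
    have hfm : ∀ m : Fin M, Continuous fun x : ℂ × ℂ => f (x.1, x.2, ((m : ℕ) : ℝ)) :=
      fun m => by fun_prop
    obtain ⟨C, hC, hle⟩ := hf.exists_abs_le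
    -- Freezing the label gives one test function on `ℂ × ℂ` per sub-band; the label only multiplies
    -- the growth constant by `1 + m²`.
    have hgrow : ∀ m : Fin M, ∃ C, 0 ≤ C ∧ ∀ x : ℂ × ℂ,
        |f (x.1, x.2, ((m : ℕ) : ℝ))| ≤ C * (1 + ‖x‖ ^ 2) := fun m => by
      refine ⟨C * (1 + (m : ℝ) ^ 2), by positivity, fun x => (hle _).trans ?_⟩
      rw [mul_assoc]
      refine mul_le_mul_of_nonneg_left ?_ hC
      have h1 : ‖(x.1, x.2, ((m : ℕ) : ℝ))‖ ≤ max ‖x‖ m := by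
        refine max_le ((norm_fst_le x).trans (le_max_left _ _)) (max_le ?_ ?_)
        · exact (norm_snd_le x).trans (le_max_left _ _)
        · simp
      have h2 := pow_le_pow_left₀ (norm_nonneg _) h1 2
      have h3 : (max ‖x‖ (m : ℝ)) ^ 2 ≤ ‖x‖ ^ 2 + (m : ℝ) ^ 2 := by
        rcases max_cases ‖x‖ (m : ℝ) with h | h <;> rw [h.1] <;> nlinarith [sq_nonneg ‖x‖]
      have h4 : 0 ≤ (m : ℝ) ^ 2 * ‖x‖ ^ 2 := by positivity
      linarith
    have hint : ∀ m : Fin M, Integrable (fun x : ℂ × ℂ => f (x.1, x.2, ((m : ℕ) : ℝ)))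
        (bandLaw α v (P m)) := fun m => by
      obtain ⟨C', -, h'⟩ := hgrow m
      exact integrable_bandLaw_of_le (hfm m) h' _ _ _
    refine ⟨integrable_agnLaw hfc hint, ?_⟩
    rw [integral_agnLaw hδ0 hfc hint]
    refine (tendsto_finsetSum Finset.univ fun m _ => hω m _ (hfm m) (hgrow m)).congr fun N => ?_
    exact sum_bandAverage (a N) (fun k => (spectrumVec Q (V N ω) (fun k => z N k ω) k, z N k ω))
      fun m x => f (x.1, x.2, ((m : ℕ) : ℝ))
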